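/- **Theorem.** Let $0\le p\le q$ be integers and let $a=(a_1,\dots,a_p)$, $b=(b_1,\dots,b_q)$ be vectors of positive real numbers. Write $e_k$ for the $k$-th elementary symmetric polynomial ($e_0=1$) and put $r=q-p$. Assume that at least one of the following holds: (i) (chain condition) $\displaystyle \frac{e_q(b)}{e_p(a)}\le\frac{e_{q-1}(b)}{e_{p-1}(a)}\le\cdots\le\frac{e_{r+1}(b)}{e_1(a)}\le e_r(b)$; (ii) (majorization condition) $a_1\le a_2\le\cdots\le a_p$ and there are distinct indices $n_1,\dots,n_p\in\{1,\dots,q\}$ with $\sum_{j=1}^k b_{n_j}\le\sum_{j=1}^k a_j$ for $k=1,\dots,p$. For $\mu\ge 0$ let $$f(\mu;x)={}_{p+2}F_{q+1}\!\left(\tfrac{\mu}{2},\tfrac{\mu}{2}+\tfrac12,a_1,\dots,a_p;\ \mu+1,b_1,\dots,b_q;\ x\right),$$ $$\hat f(\mu;x)={}_{q+2}F_{p+1}\!\left(\tfrac{\mu}{2},\tfrac{\mu}{2}+\tfrac12,b_1,\dots,b_q;\ \mu+1,a_1,\dots,a_p;\ x\right),$$ where ${}_mF_n(c;d;x)=\sum_{k\ge0}\frac{(c_1)_k\cdots(c_m)_k}{(d_1)_k\cdots(d_n)_k\,k!}x^k$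 and $(c)_k=c(c+1)\cdots(c+k-1)$, and for $g\in\{f,\hat f\}$ let $$\Delta_g(\alpha,\beta;x)=g(\mu+\alpha;x)g(\mu+\beta;x)-g(\mu;x)g(\mu+\alpha+\beta;x).$$ Let $\mu\ge0$ and let $\alpha,\beta\ge1$ be integers. Then: 1. For every $x>0$ (with $x<1$ if $p=q$) the series $f(\nu;x)$ converges for all $\nu\ge0$ and $\Delta_f(\alpha,\beta;x)\ge0$; moreover $\Delta_f(\alpha,\beta;x)>0$ unless $p=q$ and $a$ is a permutation of $b$. 2. If $\alpha+\beta\le4$, then all coefficients of the power series $\Delta_f(\alpha,\beta;x)$ in $x$ are non-negative. 3. If $p=q$, then for every $0<x<1$ the series $\hat f(\nu;x)$ converges for all $\nu\ge0$ and $\Delta_{\hat f}(\alpha,\beta;x)\le0$; moreover $\Delta_{\hat f}(\alpha,\beta;x)<0$ unless $a$ is a permutation of $b$. 4. If $\alpha+\beta\le4$, then all coefficients of the power series $\Delta_{\hat f}(\alpha,\beta;x)$ in $x$ are non-positive (for $p<q$ the series $\hat f$ is understood as a formal power series). -/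

import Mathlib

noncomputable section

namespace TuranHypergeometric

/-- The coefficient of `z ^ n` in the generalized hypergeometric series `pFq(a; b; z)`:
`(a₁)ₙ ⋯ (aₚ)ₙ / ((b₁)ₙ ⋯ (b_q)ₙ n!)`, where `(c)ₙ` is the rising factorial. -/
def hyperCoeff {p q : ℕ} (a : Fin p → ℝ) (b : Fin q → ℝ) (n : ℕ) : ℝ :=
  (∏ i, (ascPochhammer ℝ n).eval (a i)) /
    ((∏ j, (ascPochhammer ℝ n).eval (b j)) * (Nat.factorial n : ℝ))

/-- The generalized hypergeometric series as a formal power series. -/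
def hyperSeries {p q : ℕ} (a : Fin p → ℝ) (b : Fin q → ℝ) : PowerSeries ℝ :=
  PowerSeries.mk (hyperCoeff a b)

/-- The generalized hypergeometric function (the sum of the series, where it converges). -/
def hyperFun {p q : ℕ} (a : Fin p → ℝ) (b : Fin q → ℝ) (x : ℝ) : ℝ :=
  ∑' n : ℕ, hyperCoeff a b n * x ^ n

/-- The numerator parameters `μ/2, μ/2 + 1/2, a₁, …, aₚ`. -/
def upperParams {p : ℕ} (a : Fin p → ℝ) (μ : ℝ) : Fin (p + 2) → ℝ :=
  Matrix.vecCons (μ / 2) (Matrix.vecCons (μ / 2 + 1 / 2) a)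

/-- The denominator parameters `μ + 1, b₁, …, b_q`. -/
def lowerParams {q : ℕ} (b : Fin q → ℝ) (μ : ℝ) : Fin (q + 1) → ℝ :=
  Matrix.vecCons (μ + 1) b

/-- The generalized Turánian `F(μ+α) F(μ+β) - F(μ) F(μ+α+β)` of a family indexed by a real
parameter; the values of `F` may be real numbers or formal power series. -/
def turanian {R : Type*} [CommRing R] (F : ℝ → R) (μ α β : ℝ) : R :=
  F (μ + α) * F (μ + β) - F μ * F (μ + α + β)

/-- The multiset of the parameters in a vector. -/
def paramMultiset {p : ℕ} (a : Fin p → ℝ) : Multiset ℝ :=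
  (Finset.univ : Finset (Fin p)).val.map a

/-- The chain of inequalities between quotients of elementary symmetric polynomials, with
`r = q - p`: `e_q(b)/e_p(a) ≤ e_{q-1}(b)/e_{p-1}(a) ≤ ⋯ ≤ e_{r+1}(b)/e_1(a) ≤ e_r(b)/e_0(a)`.
It is meant for `p ≤ q`. -/
def SymmetricChain {p q : ℕ} (a : Fin p → ℝ) (b : Fin q → ℝ) : Prop :=
  ∀ k : ℕ, k < p →
    (paramMultiset b).esymm (q - p + (k + 1)) / (paramMultiset a).esymm (k + 1) ≤
      (paramMultiset b).esymm (q - p + k) / (paramMultiset a).esymm k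

/-- The majorization condition: `a₁ ≤ ⋯ ≤ aₚ`, and for some `p` distinct indices `n₁, …, nₚ`,
`b_{n₁} + ⋯ + b_{nₖ} ≤ a₁ + ⋯ + aₖ` for `k = 1, …, p`. -/
def MajorizationCondition {p q : ℕ} (a : Fin p → ℝ) (b : Fin q → ℝ) : Prop :=
  Monotone a ∧ ∃ n : Fin p ↪ Fin q, ∀ k : Fin p,
    ∑ j ∈ Finset.Iic k, b (n j) ≤ ∑ j ∈ Finset.Iic k, a j

end TuranHypergeometric

end

namespace TuranHypergeometric

open Polynomial PowerSeries Filter Topology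
open Finset.HasAntidiagonal (antidiagonal)

/-! For `p = q = 0` the series is the power `B ^ ν` of `B = 2 / (1 + √(1 - x))`, so its Turánian
vanishes identically. In general `f(ν; x)` is this series with its `k`-th coefficient `baseCoeff k
ν` multiplied by a weight `f k = pochQuot a b k` independent of `ν`.

Symmetrizing, twice the coefficient of `x ^ m` in the Turánian with shifts `1, σ` is the sum of `f k
* f n * symTerm σ μ k n` over `k + n = m`. The numbers `symTerm` sum to zero (`sum_symTerm`, from
the unweighted case). For `σ = 1, 2, 3` and fixed `k + n` they change sign at most once, from
negative to positive, as `k * n` grows (`mul_le_mul_of_symTerm_neg_of_pos`). If the weights are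
log-concave, `f k * f n` also grows with `k * n`, and a Chebyshev-type argument
(`sum_mul_nonneg_of_sum_eq_zero`) gives the sign. The inverse weights are log-convex and give the
opposite sign.

Log-concavity of the weights means that `∏ (aᵢ + x) / ∏ (bⱼ + x)` decreases along `x = 0, 1, 2, …`.
The chain condition yields this through the minors of the coefficients of the two polynomials, the
majorization condition through convexity of `t ↦ log ((t + y) / (t + x))` and Abel summation.

For function values only `α = β = 1` is needed: it says that `n ↦ f(μ + n; x)` is log-concave, which
implies the inequality for all integer shifts. Strictness comes from the coefficient of `x ^ 2`. -/

/-! ### The unweighted coefficients and their recurrences. -/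

/-- The quotient `(a₁)ₖ ⋯ (aₚ)ₖ / ((b₁)ₖ ⋯ (b_q)ₖ)` of products of rising factorials. -/
noncomputable def pochQuot {p q : ℕ} (a : Fin p → ℝ) (b : Fin q → ℝ) (k : ℕ) : ℝ :=
  (∏ i, (ascPochhammer ℝ k).eval (a i)) / ∏ j, (ascPochhammer ℝ k).eval (b j)

/-- The coefficient `(ν/2)ₖ (ν/2+1/2)ₖ / ((ν+1)ₖ k!)` of the series with `p = q = 0`. -/
noncomputable def baseCoeff (k : ℕ) (ν : ℝ) : ℝ :=
  (ascPochhammer ℝ k).eval (ν / 2) * (ascPochhammer ℝ k).eval (ν / 2 + 1 / 2) /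
    ((ascPochhammer ℝ k).eval (ν + 1) * (Nat.factorial k : ℝ))

/-- The factor of `baseCoeff (k + 1) ν` that is positive for `ν ≥ 0`. -/
noncomputable def baseFactor (k : ℕ) (ν : ℝ) : ℝ :=
  (ascPochhammer ℝ k).eval (ν + k + 2) / (4 ^ (k + 1) * (Nat.factorial (k + 1) : ℝ))

theorem hyperCoeff_upper_lower {p q : ℕ} (a : Fin p → ℝ) (b : Fin q → ℝ) (ν : ℝ) (k : ℕ) :
    hyperCoeff (upperParams a ν) (lowerParams b ν) k = pochQuot a b k * baseCoeff k ν := by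
  simp only [hyperCoeff, upperParams, lowerParams, pochQuot, baseCoeff, Fin.prod_univ_succ,
    Matrix.cons_val_zero, Matrix.cons_val_succ]
  rw [div_mul_div_comm]
  congr 1 <;> ring

theorem eval_ascPochhammer_succ_left (n : ℕ) (x : ℝ) :
    (ascPochhammer ℝ (n + 1)).eval x = x * (ascPochhammer ℝ n).eval (x + 1) := by
  simp [ascPochhammer_succ_left]

theorem eval_ascPochhammer_add (n m : ℕ) (x : ℝ) :
    (ascPochhammer ℝ (n + m)).eval x =
      (ascPochhammer ℝ n).eval x * (ascPochhammer ℝ m).eval (x + n) := by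
  simp [← ascPochhammer_mul]

theorem eval_ascPochhammer_half (n : ℕ) (x : ℝ) :
    (ascPochhammer ℝ n).eval (x / 2) * (ascPochhammer ℝ n).eval (x / 2 + 1 / 2) =
      (ascPochhammer ℝ (2 * n)).eval x / 4 ^ n := by
  induction n with
  | zero => simp
  | succ n ih =>
    rw [show 2 * (n + 1) = 2 * n + 1 + 1 by ring, ascPochhammer_succ_eval, ascPochhammer_succ_eval,
      ascPochhammer_succ_eval, ascPochhammer_succ_eval, mul_mul_mul_comm, ih]
    push_cast
    rw [pow_succ]
    field_simp
    ring

@[simp] theorem baseCoeff_zero (ν : ℝ) : baseCoeff 0 ν = 1 := by simp [baseCoeff]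

theorem baseCoeff_succ (k : ℕ) {ν : ℝ} (hν : 0 ≤ ν) :
    baseCoeff (k + 1) ν = ν * baseFactor k ν := by
  have h1 : 0 < (ascPochhammer ℝ (k + 1)).eval (ν + 1) := ascPochhammer_pos _ _ (by linarith)
  rw [baseCoeff, baseFactor, eval_ascPochhammer_half,
    show 2 * (k + 1) = (k + 1 + k) + 1 by ring, eval_ascPochhammer_succ_left,
    eval_ascPochhammer_add]
  have : ν + 1 + ((k + 1 : ℕ) : ℝ) = ν + k + 2 := by push_cast; ring
  rw [this]
  field_simp

theorem baseFactor_pos (k : ℕ) {ν : ℝ} (hν : 0 ≤ ν) : 0 < baseFactor k ν :=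
  div_pos (ascPochhammer_pos _ _ (by positivity)) (by positivity)

theorem baseFactor_add_one (k : ℕ) (ν : ℝ) :
    baseFactor k (ν + 1) * (ν + k + 2) = baseFactor k ν * (ν + 2 * k + 2) := by
  have h := eval_ascPochhammer_succ_left k (ν + k + 2)
  rw [ascPochhammer_succ_eval] at h
  have h2 : ν + 1 + k + 2 = ν + k + 2 + 1 := by ring
  rw [baseFactor, baseFactor, h2]
  field_simp
  linear_combination -h

theorem baseCoeff_nonneg (k : ℕ) {ν : ℝ} (hν : 0 ≤ ν) : 0 ≤ baseCoeff k ν := by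
  cases k with
  | zero => simp
  | succ k => rw [baseCoeff_succ k hν]; exact mul_nonneg hν (baseFactor_pos k hν).le

theorem eval_ascPochhammer_mono (n : ℕ) {x y : ℝ} (hx : 0 < x) (hxy : x ≤ y) :
    (ascPochhammer ℝ n).eval x ≤ (ascPochhammer ℝ n).eval y := by
  induction n with
  | zero => simp
  | succ n ih =>
    rw [ascPochhammer_succ_eval, ascPochhammer_succ_eval]
    have := ascPochhammer_pos n x hx
    gcongr
    exact ascPochhammer_pos n y (hx.trans_le hxy) |>.le

theorem baseCoeff_mono (k : ℕ) {ν ρ : ℝ} (hν : 0 ≤ ν) (h : ν ≤ ρ) :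
    baseCoeff k ν ≤ baseCoeff k ρ := by
  cases k with
  | zero => simp
  | succ k =>
    rw [baseCoeff_succ k hν, baseCoeff_succ k (hν.trans h)]
    refine mul_le_mul h ?_ (baseFactor_pos k hν).le (hν.trans h)
    unfold baseFactor
    gcongr
    exact eval_ascPochhammer_mono k (by positivity) (by linarith)

/-- This is `B = 1 + (x / 4) * B ^ 2` multiplied by `B ^ ν`, read off coefficientwise. -/
theorem baseCoeff_add_one (k : ℕ) {ν : ℝ} (hν : 0 ≤ ν) :
    baseCoeff (k + 1) (ν + 1) = baseCoeff (k + 1) ν + baseCoeff k (ν + 2) / 4 := by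
  rw [baseCoeff_succ k hν, baseCoeff_succ k (by positivity)]
  cases k with
  | zero => simp [baseFactor]; ring
  | succ j =>
    rw [baseCoeff_succ j (by positivity)]
    have h1 : (ascPochhammer ℝ (j + 1)).eval (ν + (j + 1 : ℕ) + 2) =
        (ν + j + 3) * (ascPochhammer ℝ j).eval (ν + j + 4) := by
      rw [eval_ascPochhammer_succ_left]; push_cast; ring_nf
    have h2 : (ascPochhammer ℝ (j + 1)).eval (ν + 1 + (j + 1 : ℕ) + 2) =
        (ascPochhammer ℝ j).eval (ν + j + 4) * (ν + 2 * j + 4) := by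
      rw [ascPochhammer_succ_eval]; push_cast; ring_nf
    have h3 : ν + 2 + j + 2 = ν + j + 4 := by ring
    rw [baseFactor, baseFactor, baseFactor, h1, h2, h3, Nat.factorial_succ (j + 1), pow_succ]
    push_cast
    field_simp
    ring

/-- The series with weights `f`: the coefficient of `z ^ k` is `f k * baseCoeff k ν`. -/
noncomputable def weightedSeries (f : ℕ → ℝ) (ν : ℝ) : PowerSeries ℝ :=
  PowerSeries.mk fun k => f k * baseCoeff k ν

/-- Both sides are the coefficient of `x ^ m` in `B ^ (μ + ν + 1)`. The power law itself is avoided: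
the recurrence `baseCoeff_add_one` reduces both sides to degree `m`, where two unit shifts carry `(μ
+ 2, ν)` through `(μ + 1, ν + 1)` to `(μ, ν + 2)`. -/
theorem sum_baseCoeff_mul_shift (m : ℕ) {μ ν : ℝ} (hμ : 0 ≤ μ) (hν : 0 ≤ ν) :
    ∑ x ∈ antidiagonal m, baseCoeff x.1 (μ + 1) * baseCoeff x.2 ν =
      ∑ x ∈ antidiagonal m, baseCoeff x.1 μ * baseCoeff x.2 (ν + 1) := by
  induction m generalizing μ ν with
  | zero => simp
  | succ m ih =>
    have h1 := ih (μ := μ + 1) (ν := ν) (by positivity) hν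
    have h2 := ih (μ := μ) (ν := ν + 1) hμ (by positivity)
    have e : μ + 1 + 1 = μ + 2 := by ring
    have e' : ν + 1 + 1 = ν + 2 := by ring
    rw [e] at h1
    rw [e'] at h2
    have key1 : ∑ x ∈ antidiagonal (m + 1), baseCoeff x.1 (μ + 1) * baseCoeff x.2 ν =
        ∑ x ∈ antidiagonal (m + 1), baseCoeff x.1 μ * baseCoeff x.2 ν +
          (∑ x ∈ antidiagonal m, baseCoeff x.1 (μ + 2) * baseCoeff x.2 ν) / 4 := by
      rw [Finset.Nat.sum_antidiagonal_succ, Finset.Nat.sum_antidiagonal_succ, add_assoc,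
        Finset.sum_div, ← Finset.sum_add_distrib]
      simp only [baseCoeff_add_one _ hμ, baseCoeff_zero]
      congr 1
      exact Finset.sum_congr rfl fun x _ => by ring
    have key2 : ∑ x ∈ antidiagonal (m + 1), baseCoeff x.1 μ * baseCoeff x.2 (ν + 1) =
        ∑ x ∈ antidiagonal (m + 1), baseCoeff x.1 μ * baseCoeff x.2 ν +
          (∑ x ∈ antidiagonal m, baseCoeff x.1 μ * baseCoeff x.2 (ν + 2)) / 4 := by
      rw [Finset.Nat.sum_antidiagonal_succ', Finset.Nat.sum_antidiagonal_succ', add_assoc,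
        Finset.sum_div, ← Finset.sum_add_distrib]
      simp only [baseCoeff_add_one _ hν, baseCoeff_zero]
      congr 1
      exact Finset.sum_congr rfl fun x _ => by ring
    rw [key1, key2, h1, h2]

/-! ### The single sign change of the symmetrized terms. -/

/-- Successive values have ratio `(ν + 2k + 2) / (ν + k + 2)`; a common denominator turns all five
into polynomials times one positive factor, so signs can be studied polynomially. -/
theorem exists_baseFactor_eq (k : ℕ) {μ : ℝ} (hμ : 0 ≤ μ) :
    ∃ E : ℝ, 0 < E ∧
      baseFactor k μ = E * ((μ + k + 2) * (μ + k + 3) * (μ + k + 4) * (μ + k + 5)) ∧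
      baseFactor k (μ + 1) =
        E * ((μ + 2 * k + 2) * (μ + k + 3) * (μ + k + 4) * (μ + k + 5)) ∧
      baseFactor k (μ + 2) =
        E * ((μ + 2 * k + 2) * (μ + 2 * k + 3) * (μ + k + 4) * (μ + k + 5)) ∧
      baseFactor k (μ + 3) =
        E * ((μ + 2 * k + 2) * (μ + 2 * k + 3) * (μ + 2 * k + 4) * (μ + k + 5)) ∧
      baseFactor k (μ + 4) =
        E * ((μ + 2 * k + 2) * (μ + 2 * k + 3) * (μ + 2 * k + 4) * (μ + 2 * k + 5)) := by
  have step (ν ρ : ℝ) (hρ : ν + 1 = ρ) (hν : 0 ≤ ν) :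
      baseFactor k ρ = baseFactor k ν * (ν + 2 * k + 2) / (ν + k + 2) := by
    rw [← hρ, eq_div_iff (by positivity), baseFactor_add_one]
  have h1 := step μ (μ + 1) rfl hμ
  have h2 := step (μ + 1) (μ + 2) (by ring) (by positivity)
  have h3 := step (μ + 2) (μ + 3) (by ring) (by positivity)
  have h4 := step (μ + 3) (μ + 4) (by ring) (by positivity)
  have n2 : μ + k + 2 ≠ 0 := by positivity
  have n3 : μ + k + 3 ≠ 0 := by positivity
  have n4 : μ + k + 4 ≠ 0 := by positivity
  have n5 : μ + k + 5 ≠ 0 := by positivity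
  rw [show μ + 1 + 2 * k + 2 = μ + 2 * k + 3 by ring, show μ + 1 + k + 2 = μ + k + 3 by ring] at h2
  rw [show μ + 2 + 2 * k + 2 = μ + 2 * k + 4 by ring, show μ + 2 + k + 2 = μ + k + 4 by ring] at h3
  rw [show μ + 3 + 2 * k + 2 = μ + 2 * k + 5 by ring, show μ + 3 + k + 2 = μ + k + 5 by ring] at h4
  have h0 := baseFactor_pos k hμ
  refine ⟨baseFactor k μ / ((μ + k + 2) * (μ + k + 3) * (μ + k + 4) * (μ + k + 5)),
    by positivity, ?_, ?_, ?_, ?_, ?_⟩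
  · field_simp
  · rw [h1]; field_simp
  · rw [h2, h1]; field_simp
  · rw [h3, h2, h1]; field_simp
  · rw [h4, h3, h2, h1]; field_simp

/-- The polynomial `p₀ + p₁ t + p₂ t ^ 2 + p₃ t ^ 3 + p₄ t ^ 4`. -/
def quartic (p₀ p₁ p₂ p₃ p₄ t : ℝ) : ℝ :=
  p₀ + p₁ * t + p₂ * t ^ 2 + p₃ * t ^ 3 + p₄ * t ^ 4

theorem div_le_div_of_nonpos_left_of_le {p s t : ℝ} (hp : p ≤ 0) (hs : 0 < s) (hst : s ≤ t) :
    p / s ≤ p / t := by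
  rw [div_eq_mul_inv, div_eq_mul_inv]
  exact mul_le_mul_of_nonpos_left (inv_anti₀ hs hst) hp

/-- A quartic whose coefficients change sign once, from negative to positive, stays non-negative
from its first positive argument on where it is non-negative. -/
theorem quartic_nonneg_of_le {p₀ p₁ p₂ p₃ p₄ s t : ℝ} (h₀ : p₀ ≤ 0) (h₁₂ : 0 ≤ p₂ ∨ p₁ ≤ 0)
    (h₃ : 0 ≤ p₃) (h₄ : 0 ≤ p₄) (hs : 0 < s) (hst : s ≤ t)
    (h : 0 ≤ quartic p₀ p₁ p₂ p₃ p₄ s) : 0 ≤ quartic p₀ p₁ p₂ p₃ p₄ t := by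
  have ht : 0 < t := hs.trans_le hst
  unfold quartic at *
  have i0 : p₀ / s ≤ p₀ / t := div_le_div_of_nonpos_left_of_le h₀ hs hst
  -- Dividing the quartic by `t` when `0 ≤ p₂`, or by `t ^ 2` when `p₁ ≤ 0`, leaves only terms that
  -- are constant or non-decreasing in `t > 0`.
  rcases h₁₂ with h₂ | h₁
  · have hs' : 0 ≤ p₀ / s + p₁ + p₂ * s + p₃ * s ^ 2 + p₄ * s ^ 3 := by
      refine (div_nonneg h hs.le).trans_eq ?_
      field_simp
    have ht' : 0 ≤ p₀ / t + p₁ + p₂ * t + p₃ * t ^ 2 + p₄ * t ^ 3 := by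
      refine hs'.trans ?_
      gcongr
    refine (mul_nonneg ht' ht.le).trans_eq ?_
    field_simp
  · have hs' : 0 ≤ p₀ / s ^ 2 + p₁ / s + p₂ + p₃ * s + p₄ * s ^ 2 := by
      refine (div_nonneg h (pow_pos hs 2).le).trans_eq ?_
      field_simp
    have ht' : 0 ≤ p₀ / t ^ 2 + p₁ / t + p₂ + p₃ * t + p₄ * t ^ 2 := by
      refine hs'.trans ?_
      have i1 : p₁ / s ≤ p₁ / t := div_le_div_of_nonpos_left_of_le h₁ hs hst
      have i2 : p₀ / s ^ 2 ≤ p₀ / t ^ 2 :=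
        div_le_div_of_nonpos_left_of_le h₀ (by positivity) (by gcongr)
      gcongr
    refine (mul_nonneg ht' (pow_pos ht 2).le).trans_eq ?_
    field_simp

/-- The symmetrized term of index `(k, n)` in the coefficients of the Turánian with shifts `1`
and `σ`, apart from the weights. -/
noncomputable def symTerm (σ μ : ℝ) (k n : ℕ) : ℝ :=
  baseCoeff k (μ + 1) * baseCoeff n (μ + σ) + baseCoeff n (μ + 1) * baseCoeff k (μ + σ) -
    baseCoeff k μ * baseCoeff n (μ + σ + 1) - baseCoeff n μ * baseCoeff k (μ + σ + 1)

theorem symTerm_comm (σ μ : ℝ) (k n : ℕ) : symTerm σ μ k n = symTerm σ μ n k := by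
  unfold symTerm; ring

theorem symTerm_zero_left_nonpos {σ μ : ℝ} (hσ : 0 ≤ σ) (hμ : 0 ≤ μ) (n : ℕ) :
    symTerm σ μ 0 n ≤ 0 := by
  cases n with
  | zero => simp [symTerm]
  | succ n =>
    have h := baseCoeff_mono n (show 0 ≤ μ + 2 by positivity)
      (show μ + 2 ≤ μ + σ + 2 by linarith)
    simp only [symTerm, baseCoeff_zero, baseCoeff_add_one n hμ,
      baseCoeff_add_one n (show 0 ≤ μ + σ by positivity)]
    linarith

/-- Up to a positive factor the term is a symmetric polynomial in `k + 1` and `n + 1`, hence a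
polynomial in their sum `m = N + 1` and their product. The witnesses are its coefficients as a
polynomial in the product; the degree is 2 here, 3 for `σ = 2` and 4 for `σ = 3`. -/
theorem exists_quartic_symTerm_one (N : ℕ) {μ : ℝ} (hμ : 0 ≤ μ) :
    ∃ p₀ p₁ p₂ p₃ p₄ : ℝ, p₀ ≤ 0 ∧ (0 ≤ p₂ ∨ p₁ ≤ 0) ∧ 0 ≤ p₃ ∧ 0 ≤ p₄ ∧
      ∀ k n : ℕ, k + n + 1 = N → ∃ E : ℝ, 0 < E ∧ symTerm 1 μ (k + 1) (n + 1) =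
        E * quartic p₀ p₁ p₂ p₃ p₄ ((k + 1) * (n + 1)) := by
  obtain ⟨m, hm⟩ : ∃ m : ℝ, m = N + 1 := ⟨_, rfl⟩
  have hN : (0 : ℝ) ≤ N := N.cast_nonneg
  have hm0 : 0 ≤ m := by rw [hm]; positivity
  refine ⟨(8 * μ + 14 * μ ^ 2 + 7 * μ ^ 3 + 1 * μ ^ 4) * m + (-8 * μ - 14 * μ ^ 2 - 7 * μ ^ 3 - 1
    * μ ^ 4) * m ^ 2,
    (32 + 104 * μ + 98 * μ ^ 2 + 34 * μ ^ 3 + 4 * μ ^ 4) + (16 + 16 * μ + 2 * μ ^ 2) * m,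
    (8),
    0,
    0, ?_, ?_, ?_, ?_, ?_⟩
  · rw [← sub_nonneg, hm]
    -- Rewritten in `N = m - 1`, the polynomial `-p₀` has only non-negative coefficients.
    have : 0 ≤ (8 * μ + 14 * μ ^ 2 + 7 * μ ^ 3 + 1 * μ ^ 4) * (N : ℝ) + (8 * μ + 14 * μ ^ 2 + 7 * μ ^
      3 + 1 * μ ^ 4) * (N : ℝ) ^ 2 := by
      positivity
    refine this.trans_eq ?_
    ring
  · left; positivity
  · positivity
  · positivity
  · intro k n hkn
    obtain ⟨E, hE, e0, e1, e2, e3, e4⟩ := exists_baseFactor_eq k hμ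
    obtain ⟨D, hD, d0, d1, d2, d3, d4⟩ := exists_baseFactor_eq n hμ
    have hm' : m = k + n + 2 := by rw [hm, ← hkn]; push_cast; ring
    refine ⟨E * D * ((μ + k + 5) * (μ + n + 5)) * ((μ + k + 4) * (μ + n + 4)), by positivity, ?_⟩
    rw [symTerm, show μ + 1 + 1 = μ + 2 by ring]
    simp only [baseCoeff_succ _ hμ, baseCoeff_succ _ (show 0 ≤ μ + 1 by positivity), baseCoeff_succ _ (show 0 ≤ μ + 2 by positivity),
      e0, d0, e1, d1, e2, d2, hm', quartic]
    ring

theorem exists_quartic_symTerm_two (N : ℕ) {μ : ℝ} (hμ : 0 ≤ μ) :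
    ∃ p₀ p₁ p₂ p₃ p₄ : ℝ, p₀ ≤ 0 ∧ (0 ≤ p₂ ∨ p₁ ≤ 0) ∧ 0 ≤ p₃ ∧ 0 ≤ p₄ ∧
      ∀ k n : ℕ, k + n + 1 = N → ∃ E : ℝ, 0 < E ∧ symTerm 2 μ (k + 1) (n + 1) =
        E * quartic p₀ p₁ p₂ p₃ p₄ ((k + 1) * (n + 1)) := by
  obtain ⟨m, hm⟩ : ∃ m : ℝ, m = N + 1 := ⟨_, rfl⟩
  have hN : (0 : ℝ) ≤ N := N.cast_nonneg
  have hm0 : 0 ≤ m := by rw [hm]; positivity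
  refine ⟨(72 * μ + 204 * μ ^ 2 + 216 * μ ^ 3 + 106 * μ ^ 4 + 24 * μ ^ 5 + 2 * μ ^ 6) * m + (12 *
    μ - 32 * μ ^ 2 - 99 * μ ^ 3 - 74 * μ ^ 4 - 21 * μ ^ 5 - 2 * μ ^ 6) * m ^ 2 + (-84 * μ -
    172 * μ ^ 2 - 117 * μ ^ 3 - 32 * μ ^ 4 - 3 * μ ^ 5) * m ^ 3,
    (288 + 1224 * μ + 1896 * μ ^ 2 + 1440 * μ ^ 3 + 564 * μ ^ 4 + 108 * μ ^ 5 + 8 * μ ^ 6) +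
    (456 + 1440 * μ + 1568 * μ ^ 2 + 738 * μ ^ 3 + 154 * μ ^ 4 + 12 * μ ^ 5) * m + (120 + 84
    * μ - 34 * μ ^ 2 - 30 * μ ^ 3 - 4 * μ ^ 4) * m ^ 2,
    (320 + 840 * μ + 616 * μ ^ 2 + 168 * μ ^ 3 + 16 * μ ^ 4) + (136 + 96 * μ + 8 * μ ^ 2) *
    m,
    (32),
    0, ?_, ?_, ?_, ?_, ?_⟩
  · rw [← sub_nonneg, hm]
    have : 0 ≤ (156 * μ + 376 * μ ^ 2 + 333 * μ ^ 3 + 138 * μ ^ 4 + 27 * μ ^ 5 + 2 * μ ^ 6) * (N : ℝ)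
      + (240 * μ + 548 * μ ^ 2 + 450 * μ ^ 3 + 170 * μ ^ 4 + 30 * μ ^ 5 + 2 * μ ^ 6) * (N :
      ℝ) ^ 2 + (84 * μ + 172 * μ ^ 2 + 117 * μ ^ 3 + 32 * μ ^ 4 + 3 * μ ^ 5) * (N : ℝ) ^ 3 := by
      positivity
    refine this.trans_eq ?_
    ring
  · left; positivity
  · positivity
  · positivity
  · intro k n hkn
    obtain ⟨E, hE, e0, e1, e2, e3, e4⟩ := exists_baseFactor_eq k hμ
    obtain ⟨D, hD, d0, d1, d2, d3, d4⟩ := exists_baseFactor_eq n hμ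
    have hm' : m = k + n + 2 := by rw [hm, ← hkn]; push_cast; ring
    refine ⟨E * D * ((μ + k + 5) * (μ + n + 5)), by positivity, ?_⟩
    rw [symTerm, show μ + 2 + 1 = μ + 3 by ring]
    simp only [baseCoeff_succ _ hμ, baseCoeff_succ _ (show 0 ≤ μ + 1 by positivity), baseCoeff_succ _ (show 0 ≤ μ + 2 by positivity), baseCoeff_succ _ (show 0 ≤ μ + 3 by positivity),
      e0, d0, e1, d1, e2, d2, e3, d3, hm', quartic]
    ring

theorem exists_quartic_symTerm_three (N : ℕ) {μ : ℝ} (hμ : 0 ≤ μ) :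
    ∃ p₀ p₁ p₂ p₃ p₄ : ℝ, p₀ ≤ 0 ∧ (0 ≤ p₂ ∨ p₁ ≤ 0) ∧ 0 ≤ p₃ ∧ 0 ≤ p₄ ∧
      ∀ k n : ℕ, k + n + 1 = N → ∃ E : ℝ, 0 < E ∧ symTerm 3 μ (k + 1) (n + 1) =
        E * quartic p₀ p₁ p₂ p₃ p₄ ((k + 1) * (n + 1)) := by
  obtain ⟨m, hm⟩ : ∃ m : ℝ, m = N + 1 := ⟨_, rfl⟩
  have hN : (0 : ℝ) ≤ N := N.cast_nonneg
  have hm0 : 0 ≤ m := by rw [hm]; positivity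
  refine ⟨(1152 * μ + 3984 * μ ^ 2 + 5628 * μ ^ 3 + 4212 * μ ^ 4 + 1803 * μ ^ 5 + 441 * μ ^ 6 + 57
    * μ ^ 7 + 3 * μ ^ 8) * m + (768 * μ + 1552 * μ ^ 2 + 588 * μ ^ 3 - 722 * μ ^ 4 - 768 * μ
    ^ 5 - 287 * μ ^ 6 - 48 * μ ^ 7 - 3 * μ ^ 8) * m ^ 2 + (-1008 * μ - 3468 * μ ^ 2 - 4536 *
    μ ^ 3 - 2865 * μ ^ 4 - 927 * μ ^ 5 - 147 * μ ^ 6 - 9 * μ ^ 7) * m ^ 3 + (-912 * μ - 2068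
    * μ ^ 2 - 1680 * μ ^ 3 - 625 * μ ^ 4 - 108 * μ ^ 5 - 7 * μ ^ 6) * m ^ 4,
    (4608 + 22848 * μ + 43592 * μ ^ 2 + 44196 * μ ^ 3 + 26516 * μ ^ 4 + 9678 * μ ^ 5 + 2096
    * μ ^ 6 + 246 * μ ^ 7 + 12 * μ ^ 8) + (9984 + 38976 * μ + 59814 * μ ^ 2 + 47619 * μ ^ 3
    + 21243 * μ ^ 4 + 5301 * μ ^ 5 + 687 * μ ^ 6 + 36 * μ ^ 7) * m + (7200 + 19596 * μ +
    20936 * μ ^ 2 + 10797 * μ ^ 3 + 2807 * μ ^ 4 + 351 * μ ^ 5 + 17 * μ ^ 6) * m ^ 2 + (1248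
    + 612 * μ - 1026 * μ ^ 2 - 870 * μ ^ 3 - 222 * μ ^ 4 - 18 * μ ^ 5) * m ^ 3,
    (1824 + 12096 * μ + 18680 * μ ^ 2 + 12762 * μ ^ 3 + 4316 * μ ^ 4 + 702 * μ ^ 5 + 44 * μ
    ^ 6) + (5928 + 16620 * μ + 15450 * μ ^ 2 + 6144 * μ ^ 3 + 1086 * μ ^ 4 + 72 * μ ^ 5) * m
    + (1560 + 1176 * μ + 48 * μ ^ 2 - 96 * μ ^ 3 - 12 * μ ^ 4) * m ^ 2,
    (1632 + 4152 * μ + 2616 * μ ^ 2 + 600 * μ ^ 3 + 48 * μ ^ 4) + (696 + 384 * μ + 24 * μ ^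
    2) * m,
    (96), ?_, ?_, ?_, ?_, ?_⟩
  · rw [← sub_nonneg, hm]
    have : 0 ≤ (3984 * μ + 11588 * μ ^ 2 + 13524 * μ ^ 3 + 8327 * μ ^ 4 + 2946 * μ ^ 5 + 602 * μ ^ 6
      + 66 * μ ^ 7 + 3 * μ ^ 8) * (N : ℝ) + (7728 * μ + 21260 * μ ^ 2 + 23100 * μ ^ 3 +
      13067 * μ ^ 4 + 4197 * μ ^ 5 + 770 * μ ^ 6 + 75 * μ ^ 7 + 3 * μ ^ 8) * (N : ℝ) ^ 2 +
      (4656 * μ + 11740 * μ ^ 2 + 11256 * μ ^ 3 + 5365 * μ ^ 4 + 1359 * μ ^ 5 + 175 * μ ^ 6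
      + 9 * μ ^ 7) * (N : ℝ) ^ 3 + (912 * μ + 2068 * μ ^ 2 + 1680 * μ ^ 3 + 625 * μ ^ 4 +
      108 * μ ^ 5 + 7 * μ ^ 6) * (N : ℝ) ^ 4 := by
      positivity
    refine this.trans_eq ?_
    ring
  -- Neither `p₁` nor `p₂` has a fixed sign visible from its coefficients. The certificate is `p₁ =
  -- Q * p₂ - D` with `Q` from `hq` and `D` from `hd` non-negative, so `p₂ < 0` forces `p₁ ≤ 0`.
  · refine or_iff_not_imp_left.mpr fun h => ?_
    have h := (not_le.mp h).le
    have hq : 0 ≤ 10 + μ ^ 2 + (6 + 3 / 2 * μ) * m := by positivity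
    have hd : 0 ≤ (13632 + 98112 * μ + 145032 * μ ^ 2 + 95520 * μ ^ 3 + 35324 * μ ^ 4 + 10104 * μ ^ 5 +
      2660 * μ ^ 6 + 456 * μ ^ 7 + 32 * μ ^ 8) + (60240 + 202536 * μ + 230838 * μ ^ 2 +
      135033 * μ ^ 3 + 50106 * μ ^ 4 + 12249 * μ ^ 5 + 1716 * μ ^ 6 + 102 * μ ^ 7) * m +
      (43968 + 100776 * μ + 98734 * μ ^ 2 + 49458 * μ ^ 3 + 12853 * μ ^ 4 + 1614 * μ ^ 5 +
      79 * μ ^ 6) * m ^ 2 + (8112 + 8784 * μ + 3078 * μ ^ 2 + 366 * μ ^ 3 + 6 * μ ^ 4) * m ^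
      3 := by
      positivity
    linear_combination mul_nonpos_of_nonneg_of_nonpos hq h + hd
  · positivity
  · positivity
  · intro k n hkn
    obtain ⟨E, hE, e0, e1, e2, e3, e4⟩ := exists_baseFactor_eq k hμ
    obtain ⟨D, hD, d0, d1, d2, d3, d4⟩ := exists_baseFactor_eq n hμ
    have hm' : m = k + n + 2 := by rw [hm, ← hkn]; push_cast; ring
    refine ⟨E * D, by positivity, ?_⟩
    rw [symTerm, show μ + 3 + 1 = μ + 4 by ring]
    simp only [baseCoeff_succ _ hμ, baseCoeff_succ _ (show 0 ≤ μ + 1 by positivity), baseCoeff_succ _ (show 0 ≤ μ + 3 by positivity), baseCoeff_succ _ (show 0 ≤ μ + 4 by positivity),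
      e0, d0, e1, d1, e3, d3, e4, d4, hm', quartic]
    ring

theorem mul_le_mul_of_symTerm_neg_of_pos {σ μ : ℝ} (hσ : σ = 1 ∨ σ = 2 ∨ σ = 3) (hμ : 0 ≤ μ)
    {k n k' n' : ℕ} (hkn : k + n = k' + n') (hneg : symTerm σ μ k n < 0)
    (hpos : 0 < symTerm σ μ k' n') : k * n ≤ k' * n' := by
  have hσ0 : 0 ≤ σ := by rcases hσ with rfl | rfl | rfl <;> norm_num
  -- A zero index makes the product minimal and the term non-positive, so these boundary terms fit
  -- the sign pattern; the quartic handles positive indices.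
  rcases k with _ | k
  · simp
  rcases n with _ | n
  · simp
  rcases k' with _ | k'
  · exact absurd hpos (symTerm_zero_left_nonpos hσ0 hμ n').not_gt
  rcases n' with _ | n'
  · rw [symTerm_comm] at hpos
    exact absurd hpos (symTerm_zero_left_nonpos hσ0 hμ (k' + 1)).not_gt
  by_contra! hlt
  have H : ∃ p₀ p₁ p₂ p₃ p₄ : ℝ, p₀ ≤ 0 ∧ (0 ≤ p₂ ∨ p₁ ≤ 0) ∧ 0 ≤ p₃ ∧ 0 ≤ p₄ ∧
      ∀ i j : ℕ, i + j + 1 = k + n + 1 → ∃ E : ℝ, 0 < E ∧ symTerm σ μ (i + 1) (j + 1) =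
        E * quartic p₀ p₁ p₂ p₃ p₄ ((i + 1) * (j + 1)) := by
    rcases hσ with rfl | rfl | rfl
    · exact exists_quartic_symTerm_one _ hμ
    · exact exists_quartic_symTerm_two _ hμ
    · exact exists_quartic_symTerm_three _ hμ
  obtain ⟨p₀, p₁, p₂, p₃, p₄, h0, h12, h3, h4, H⟩ := H
  obtain ⟨E, hE, e⟩ := H k n rfl
  obtain ⟨D, hD, d⟩ := H k' n' (by omega)
  rw [e] at hneg
  rw [d] at hpos
  have hq : 0 < quartic p₀ p₁ p₂ p₃ p₄ ((k' + 1) * (n' + 1)) := pos_of_mul_pos_right hpos hD.le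
  have hle : ((k' : ℝ) + 1) * (n' + 1) ≤ (k + 1) * (n + 1) := by exact_mod_cast hlt.le
  have := quartic_nonneg_of_le h0 h12 h3 h4 (by positivity) hle hq.le
  exact absurd hneg (mul_nonneg hE.le this).not_gt

/-! ### Coefficients of the Turánian. -/

/-- If `M` sums to zero and `F` is larger where `M` is positive than where `M` is negative, then
`F` and `M` are positively correlated. -/
theorem sum_mul_nonneg_of_sum_eq_zero {ι : Type*} (s : Finset ι) (F M : ι → ℝ)
    (h0 : ∑ i ∈ s, M i = 0)
    (h : ∀ i ∈ s, ∀ j ∈ s, M i < 0 → 0 < M j → F i ≤ F j) : 0 ≤ ∑ i ∈ s, F i * M i := by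
  by_cases hp : ∃ j ∈ s, 0 < M j
  · obtain ⟨j, hj, hmin⟩ := Finset.exists_min_image (s.filter fun j => 0 < M j) F
      (by simpa [Finset.Nonempty] using hp)
    rw [Finset.mem_filter] at hj
    -- Since `M` sums to zero, `F` may be shifted by the threshold `F j`, its least value where `M`
    -- is positive; then every summand is non-negative.
    have : ∑ i ∈ s, F i * M i = ∑ i ∈ s, (F i - F j) * M i := by
      simp only [sub_mul, Finset.sum_sub_distrib, ← Finset.mul_sum, h0, mul_zero, sub_zero]
    rw [this]
    refine Finset.sum_nonneg fun i hi => ?_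
    rcases lt_trichotomy (M i) 0 with hM | hM | hM
    · exact mul_nonneg_of_nonpos_of_nonpos (sub_nonpos.mpr (h i hi j hj.1 hM hj.2)) hM.le
    · simp [hM]
    · exact mul_nonneg (sub_nonneg.mpr (hmin i (by simp [hi, hM]))) hM.le
  · push Not at hp
    have := (Finset.sum_eq_zero_iff_of_nonpos hp).mp h0
    exact (Finset.sum_eq_zero fun i hi => by rw [this i hi, mul_zero]).ge

theorem coeff_weightedSeries_mul (f : ℕ → ℝ) (ν ρ : ℝ) (m : ℕ) :
    coeff m (weightedSeries f ν * weightedSeries f ρ) =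
      ∑ x ∈ antidiagonal m, f x.1 * f x.2 * (baseCoeff x.1 ν * baseCoeff x.2 ρ) := by
  rw [PowerSeries.coeff_mul]
  refine Finset.sum_congr rfl fun x _ => ?_
  simp only [weightedSeries, coeff_mk]
  ring

theorem two_mul_coeff_turan (f : ℕ → ℝ) (μ σ : ℝ) (m : ℕ) :
    2 * coeff m (weightedSeries f (μ + 1) * weightedSeries f (μ + σ) -
        weightedSeries f μ * weightedSeries f (μ + σ + 1)) =
      ∑ x ∈ antidiagonal m, f x.1 * f x.2 * symTerm σ μ x.1 x.2 := by
  rw [map_sub, coeff_weightedSeries_mul, coeff_weightedSeries_mul, ← Finset.sum_sub_distrib,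
    two_mul]
  nth_rewrite 2 [← Finset.Nat.sum_antidiagonal_swap]
  rw [← Finset.sum_add_distrib]
  refine Finset.sum_congr rfl fun x _ => ?_
  simp only [symTerm, Prod.fst_swap, Prod.snd_swap]
  ring

theorem sum_symTerm {σ μ : ℝ} (hσ : 0 ≤ σ) (hμ : 0 ≤ μ) (m : ℕ) :
    ∑ x ∈ antidiagonal m, symTerm σ μ x.1 x.2 = 0 := by
  have h := two_mul_coeff_turan (fun _ => 1) μ σ m
  rw [map_sub, coeff_weightedSeries_mul, coeff_weightedSeries_mul] at h
  simp only [one_mul] at h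
  rw [← h, sum_baseCoeff_mul_shift m hμ (show 0 ≤ μ + σ by positivity), sub_self, mul_zero]

/-- The factor `c` treats both directions at once: `c = 1` serves log-concave weights, `c = -1`
log-convex ones. -/
theorem mul_coeff_turan_nonneg {c : ℝ} {f : ℕ → ℝ}
    (hf : ∀ k n k' n', k + n = k' + n' → k * n ≤ k' * n' →
      c * (f k * f n) ≤ c * (f k' * f n'))
    {σ μ : ℝ} (hσ : σ = 1 ∨ σ = 2 ∨ σ = 3) (hμ : 0 ≤ μ) (m : ℕ) :
    0 ≤ c * coeff m (weightedSeries f (μ + 1) * weightedSeries f (μ + σ) -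
        weightedSeries f μ * weightedSeries f (μ + σ + 1)) := by
  have hσ0 : 0 ≤ σ := by rcases hσ with rfl | rfl | rfl <;> norm_num
  have h := sum_mul_nonneg_of_sum_eq_zero (antidiagonal m) (fun x => c * (f x.1 * f x.2))
    (fun x => symTerm σ μ x.1 x.2) (sum_symTerm hσ0 hμ m) fun x hx y hy hneg hpos => by
      rw [Finset.HasAntidiagonal.mem_antidiagonal] at hx hy
      have hxy := hx.trans hy.symm
      exact hf _ _ _ _ hxy (mul_le_mul_of_symTerm_neg_of_pos hσ hμ hxy hneg hpos)
  have e := two_mul_coeff_turan f μ σ m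
  simp only [mul_assoc, ← Finset.mul_sum] at h e
  rw [← e] at h
  linarith

theorem mul_coeff_turanian_nonneg {c : ℝ} {f : ℕ → ℝ}
    (hf : ∀ k n k' n', k + n = k' + n' → k * n ≤ k' * n' →
      c * (f k * f n) ≤ c * (f k' * f n'))
    {μ : ℝ} (hμ : 0 ≤ μ) {α β : ℕ} (hα : 1 ≤ α) (hβ : 1 ≤ β) (h : α + β ≤ 4) (m : ℕ) :
    0 ≤ c * coeff m (turanian (weightedSeries f) μ α β) := by
  have base : ∀ β : ℕ, 1 ≤ β → β ≤ 3 → 0 ≤ c * coeff m (turanian (weightedSeries f) μ (1 : ℕ) β) := by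
    intro β h1 h3
    have hσ : (β : ℝ) = 1 ∨ (β : ℝ) = 2 ∨ (β : ℝ) = 3 := by interval_cases β <;> simp
    have := mul_coeff_turan_nonneg hf hσ hμ m
    rwa [turanian, Nat.cast_one, show μ + 1 + (β : ℝ) = μ + β + 1 by ring]
  have symm : turanian (weightedSeries f) μ α β = turanian (weightedSeries f) μ β α := by
    rw [turanian, turanian, mul_comm (weightedSeries f (μ + α)), add_right_comm]
  by_cases h1 : α = 1
  · subst h1; exact base β hβ (by omega)
  by_cases h2 : β = 1
  · subst h2; rw [symm]; exact base α hα (by omega)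
  obtain rfl : α = 2 := by omega
  obtain rfl : β = 2 := by omega
  have e1 := base 3 (by norm_num) le_rfl
  have e2 := mul_coeff_turan_nonneg hf (σ := 1) (Or.inl rfl) (show 0 ≤ μ + 1 by positivity) m
  -- Shifts `(2, 2)` telescope into shifts `(1, 3)` at `μ` and `(1, 1)` at `μ + 1`.
  have : turanian (weightedSeries f) μ (2 : ℕ) (2 : ℕ) =
      turanian (weightedSeries f) μ (1 : ℕ) (3 : ℕ) +
      (weightedSeries f (μ + 1 + 1) * weightedSeries f (μ + 1 + 1) -
        weightedSeries f (μ + 1) * weightedSeries f (μ + 1 + 1 + 1)) := by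
    simp only [turanian, Nat.cast_one, Nat.cast_ofNat]
    ring_nf
  rw [this, map_add, mul_add]
  exact add_nonneg e1 e2

/-! ### Log-concave sequences. -/

/-- A sequence with non-increasing ratios of consecutive terms is log-concave. -/
theorem mul_le_mul_of_ratio_antitone {f R : ℕ → ℝ} (hf : ∀ k, 0 < f k)
    (hR : ∀ k, f (k + 1) = R k * f k) (hanti : Antitone R) {k n k' n' : ℕ}
    (h : k + n = k' + n') (hmul : k * n ≤ k' * n') : f k * f n ≤ f k' * f n' := by
  have main : ∀ d k n : ℕ, f k * f (k + n + 2 * d) ≤ f (k + d) * f (k + n + d) := by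
    intro d
    induction d with
    | zero => intro k n; simp
    | succ d ih =>
      intro k n
      have h1 := ih (k + 1) n
      -- Both indices move inwards by one, which costs one comparison of ratios.
      have h2 : f k * f (k + n + 2 * (d + 1)) ≤ f (k + 1) * f (k + 1 + n + 2 * d) := by
        rw [show k + n + 2 * (d + 1) = (k + 1 + n + 2 * d) + 1 by ring, hR, hR k]
        have := hanti (show k ≤ k + 1 + n + 2 * d by omega)
        have h3 := mul_pos (hf k) (hf (k + 1 + n + 2 * d))
        nlinarith
      refine h2.trans (h1.trans_eq ?_)
      rw [show k + 1 + d = k + (d + 1) by ring, show k + 1 + n + d = k + n + (d + 1) by ring]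
  have sorted : ∀ k n k' n' : ℕ, k ≤ n → k' ≤ n' → k + n = k' + n' → k * n ≤ k' * n' →
      f k * f n ≤ f k' * f n' := by
    intro k n k' n' hkn hkn' h hmul
    have hk : k ≤ k' := by
      by_contra! hlt
      nlinarith
    obtain ⟨d, rfl⟩ := Nat.exists_eq_add_of_le hk
    obtain ⟨e, rfl⟩ := Nat.exists_eq_add_of_le hkn'
    obtain rfl : n = k + e + 2 * d := by omega
    rw [show k + d + e = k + e + d by ring]
    exact main d k e
  have h' : n + k = n' + k' := by omega
  have hmul' : n * k ≤ n' * k' := by rwa [mul_comm n, mul_comm n']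
  rcases le_total k n with h1 | h1 <;> rcases le_total k' n' with h2 | h2
  · exact sorted k n k' n' h1 h2 h hmul
  · rw [mul_comm (f k')]
    exact sorted k n n' k' h1 h2 (by omega) (by rwa [mul_comm n'])
  · rw [mul_comm (f k)]
    exact sorted n k k' n' h1 h2 (by omega) (by rwa [mul_comm n])
  · rw [mul_comm (f k), mul_comm (f k')]
    exact sorted n k n' k' h1 h2 h' hmul'

/-! ### Decreasing ratio of products under the chain condition. -/

/-- By a Binet–Cauchy type identity, twice the difference of the sides is the double sum of the
minors `A i * B j - A j * B i` times `x ^ i * y ^ j - y ^ i * x ^ j`, and the two factors have the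
same sign. -/
theorem sum_mul_sum_le_of_minors_nonneg {N : ℕ} {A B : ℕ → ℝ}
    (h : ∀ i j, i ≤ j → j < N → B i * A j ≤ B j * A i) {x y : ℝ} (hx : 0 ≤ x) (hxy : x ≤ y) :
    (∑ i ∈ Finset.range N, A i * y ^ i) * ∑ i ∈ Finset.range N, B i * x ^ i ≤
      (∑ i ∈ Finset.range N, A i * x ^ i) * ∑ i ∈ Finset.range N, B i * y ^ i := by
  have hy : 0 ≤ y := hx.trans hxy
  have pow_le : ∀ i j : ℕ, i ≤ j → y ^ i * x ^ j ≤ x ^ i * y ^ j := by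
    intro i j hij
    obtain ⟨d, rfl⟩ := Nat.exists_eq_add_of_le hij
    have : x ^ d ≤ y ^ d := pow_le_pow_left₀ hx hxy d
    rw [pow_add, pow_add, ← mul_assoc, ← mul_assoc, mul_comm (y ^ i)]
    gcongr
  have key : 0 ≤ ∑ i ∈ Finset.range N, ∑ j ∈ Finset.range N,
      (A i * B j - A j * B i) * (x ^ i * y ^ j - y ^ i * x ^ j) := by
    refine Finset.sum_nonneg fun i hi => Finset.sum_nonneg fun j hj => ?_
    rw [Finset.mem_range] at hi hj
    rcases le_total i j with hij | hij
    · have := h i j hij hj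
      exact mul_nonneg (by linarith) (sub_nonneg.mpr (pow_le i j hij))
    · have h1 := h j i hij hi
      have h2 := pow_le j i hij
      exact mul_nonneg_of_nonpos_of_nonpos (by linarith) (by linarith)
  have e : ∑ i ∈ Finset.range N, ∑ j ∈ Finset.range N,
      (A i * B j - A j * B i) * (x ^ i * y ^ j - y ^ i * x ^ j) =
      2 * ((∑ i ∈ Finset.range N, A i * x ^ i) * (∑ i ∈ Finset.range N, B i * y ^ i) -
        (∑ i ∈ Finset.range N, A i * y ^ i) * ∑ i ∈ Finset.range N, B i * x ^ i) := by
    have e1 : (∑ i ∈ Finset.range N, A i * x ^ i) * (∑ i ∈ Finset.range N, B i * y ^ i) =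
        ∑ i ∈ Finset.range N, ∑ j ∈ Finset.range N, A j * x ^ j * (B i * y ^ i) := by
      rw [Finset.sum_mul_sum, Finset.sum_comm]
    have e2 : (∑ i ∈ Finset.range N, A i * y ^ i) * (∑ i ∈ Finset.range N, B i * x ^ i) =
        ∑ i ∈ Finset.range N, ∑ j ∈ Finset.range N, A j * y ^ j * (B i * x ^ i) := by
      rw [Finset.sum_mul_sum, Finset.sum_comm]
    rw [two_mul]
    nth_rewrite 1 [e1]
    nth_rewrite 1 [e2]
    rw [Finset.sum_mul_sum, Finset.sum_mul_sum]
    simp only [← Finset.sum_sub_distrib, ← Finset.sum_add_distrib]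
    refine Finset.sum_congr rfl fun i _ => Finset.sum_congr rfl fun j _ => ?_
    ring
  linarith

/-- The polynomial `∏ (X + aᵢ)`. -/
noncomputable def paramPoly {p : ℕ} (a : Fin p → ℝ) : ℝ[X] := ∏ i, (Polynomial.X + Polynomial.C (a i))

theorem eval_paramPoly {p : ℕ} (a : Fin p → ℝ) (x : ℝ) :
    (paramPoly a).eval x = ∏ i, (a i + x) := by
  simp [paramPoly, eval_prod, add_comm]

theorem paramPoly_monic {p : ℕ} (a : Fin p → ℝ) : (paramPoly a).Monic :=
  monic_prod_of_monic _ _ fun i _ => monic_X_add_C (a i)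

theorem natDegree_paramPoly {p : ℕ} (a : Fin p → ℝ) : (paramPoly a).natDegree = p := by
  simp [paramPoly, natDegree_prod_of_monic _ _ fun i _ => monic_X_add_C (a i)]

theorem coeff_paramPoly {p : ℕ} (a : Fin p → ℝ) {k : ℕ} (hk : k ≤ p) :
    (paramPoly a).coeff k = (paramMultiset a).esymm (p - k) := by
  have := Multiset.prod_X_add_C_coeff (paramMultiset a) (k := k) (by simpa [paramMultiset])
  simpa [paramPoly, paramMultiset, Finset.prod, Function.comp_def] using this

theorem coeff_paramPoly_pos {p : ℕ} {a : Fin p → ℝ} (ha : ∀ i, 0 < a i) {k : ℕ} (hk : k ≤ p) :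
    0 < (paramPoly a).coeff k := by
  rw [coeff_paramPoly a hk, paramMultiset, Finset.esymm_map_val]
  exact Finset.sum_pos (fun t _ => Finset.prod_pos fun i _ => ha i)
    (Finset.powersetCard_nonempty.mpr (by simp))

theorem roots_paramPoly {p : ℕ} (a : Fin p → ℝ) :
    (paramPoly a).roots = (paramMultiset a).map Neg.neg := by
  have : paramPoly a = (((paramMultiset a).map Neg.neg).map fun r => Polynomial.X - Polynomial.C r).prod := by
    simp [paramPoly, paramMultiset, Finset.prod, Function.comp_def]
  rw [this, roots_multiset_prod_X_sub_C]

theorem paramMultiset_eq_of_paramPoly_eq {p q : ℕ} {a : Fin p → ℝ} {b : Fin q → ℝ}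
    (h : paramPoly a = paramPoly b) : paramMultiset a = paramMultiset b := by
  have := congrArg roots h
  rw [roots_paramPoly, roots_paramPoly] at this
  exact Multiset.map_injective neg_injective this

theorem eval_paramPoly_eq_sum {p N : ℕ} (a : Fin p → ℝ) (h : p < N) (x : ℝ) :
    ∏ i, (a i + x) = ∑ k ∈ Finset.range N, (paramPoly a).coeff k * x ^ k := by
  rw [← eval_paramPoly, eval_eq_sum_range' (by rwa [natDegree_paramPoly])]

section Chain

variable {p q : ℕ} {a : Fin p → ℝ} {b : Fin q → ℝ}

/-- The coefficients of index `i` are `e_{q-i}(b)` and `e_{p-i}(a)`, so the chain says exactly that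
their quotient increases with `i ≤ p`; beyond `p` the coefficients of `paramPoly a` vanish. -/
theorem SymmetricChain.coeff_mul_le (hab : SymmetricChain a b) (hpq : p ≤ q)
    (ha : ∀ i, 0 < a i) (hb : ∀ j, 0 < b j) {i j : ℕ} (hij : i ≤ j) (hj : j < q + 1) :
    (paramPoly b).coeff i * (paramPoly a).coeff j ≤
      (paramPoly b).coeff j * (paramPoly a).coeff i := by
  by_cases hjp : j ≤ p
  · have step : ∀ d, i + d ≤ p → (paramPoly b).coeff i / (paramPoly a).coeff i ≤
        (paramPoly b).coeff (i + d) / (paramPoly a).coeff (i + d) := by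
      intro d
      induction d with
      | zero => intro _; simp
      | succ d ih =>
        intro hd
        refine (ih (by omega)).trans ?_
        have := hab (p - (i + d) - 1) (by omega)
        rw [coeff_paramPoly a (by omega), coeff_paramPoly b (by omega),
          coeff_paramPoly a (by omega), coeff_paramPoly b (by omega)]
        rwa [show q - p + (p - (i + d) - 1 + 1) = q - (i + d) by omega,
          show p - (i + d) - 1 + 1 = p - (i + d) by omega,
          show q - p + (p - (i + d) - 1) = q - (i + (d + 1)) by omega,
          show p - (i + d) - 1 = p - (i + (d + 1)) by omega] at this
    obtain ⟨d, rfl⟩ := Nat.exists_eq_add_of_le hij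
    have := step d hjp
    rwa [div_le_div_iff₀ (coeff_paramPoly_pos ha (by omega)) (coeff_paramPoly_pos ha hjp)] at this
  · rw [coeff_eq_zero_of_natDegree_lt (p := paramPoly a) (n := j)
      (by rw [natDegree_paramPoly]; omega), mul_zero]
    refine mul_nonneg (coeff_paramPoly_pos hb (by omega)).le ?_
    by_cases hi : i ≤ p
    · exact (coeff_paramPoly_pos ha hi).le
    · rw [coeff_eq_zero_of_natDegree_lt (by rw [natDegree_paramPoly]; omega)]

theorem SymmetricChain.prod_mul_prod_le (hab : SymmetricChain a b) (hpq : p ≤ q)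
    (ha : ∀ i, 0 < a i) (hb : ∀ j, 0 < b j) {x y : ℝ} (hx : 0 ≤ x) (hxy : x ≤ y) :
    (∏ i, (a i + y)) * ∏ j, (b j + x) ≤ (∏ i, (a i + x)) * ∏ j, (b j + y) := by
  simp only [eval_paramPoly_eq_sum a (Nat.lt_succ_of_le hpq),
    eval_paramPoly_eq_sum b (Nat.lt_succ_self q)]
  exact sum_mul_sum_le_of_minors_nonneg
    (fun i j hij hj => hab.coeff_mul_le hpq ha hb hij hj) hx hxy

theorem SymmetricChain.prod_mul_prod_lt (hab : SymmetricChain a b) (hpq : p ≤ q)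
    (ha : ∀ i, 0 < a i) (hb : ∀ j, 0 < b j) (hne : paramMultiset a ≠ paramMultiset b) :
    (∏ i, (a i + 1)) * ∏ j, (b j + 0) < (∏ i, (a i + 0)) * ∏ j, (b j + 1) := by
  by_contra! hle
  refine hne (paramMultiset_eq_of_paramPoly_eq ?_)
  rw [eval_paramPoly_eq_sum a (Nat.lt_succ_of_le hpq) 1,
    eval_paramPoly_eq_sum b (Nat.lt_succ_self q) 1, ← eval_paramPoly, ← eval_paramPoly,
    ← coeff_zero_eq_eval_zero, ← coeff_zero_eq_eval_zero, Finset.sum_mul, Finset.mul_sum] at hle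
  simp only [one_pow, mul_one] at hle
  -- At `x = 0` only the constant coefficient survives, so equality of the products forces equality
  -- in each of these minors.
  have hterm : ∀ j ∈ Finset.range (q + 1), (paramPoly a).coeff j * (paramPoly b).coeff 0 ≤
      (paramPoly a).coeff 0 * (paramPoly b).coeff j := by
    intro j hj
    have := hab.coeff_mul_le hpq ha hb (Nat.zero_le j) (Finset.mem_range.mp hj)
    linarith
  have heq := (Finset.sum_eq_sum_iff_of_le hterm).mp (le_antisymm (Finset.sum_le_sum hterm) hle)
  have ha0 := coeff_paramPoly_pos ha (Nat.zero_le p)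
  have hbq : (paramPoly b).coeff q = 1 := by
    simpa [Monic, leadingCoeff, natDegree_paramPoly] using paramPoly_monic b
  -- The top index compares leading coefficients: it gives `p = q` and equal constant coefficients,
  -- after which the other minors identify the polynomials.
  have hq := heq q (by simp)
  rw [hbq, mul_one] at hq
  have hqp : q = p := by
    by_contra hqp
    rw [coeff_eq_zero_of_natDegree_lt (by rw [natDegree_paramPoly]; omega), zero_mul] at hq
    exact ha0.ne hq
  have haq : (paramPoly a).coeff q = 1 := by
    rw [hqp]
    simpa [Monic, leadingCoeff, natDegree_paramPoly] using paramPoly_monic a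
  rw [haq, one_mul] at hq
  ext j
  by_cases hj : j ≤ q
  · have := heq j (by simpa [Nat.lt_succ_iff] using hj)
    rw [hq, mul_comm] at this
    exact mul_left_cancel₀ ha0.ne' this
  · rw [coeff_eq_zero_of_natDegree_lt (by rw [natDegree_paramPoly]; omega),
      coeff_eq_zero_of_natDegree_lt (by rw [natDegree_paramPoly]; omega)]

end Chain

/-! ### Decreasing ratio of products under the majorization condition. -/

section Majorization

/-- Abel summation. Keeping the last weight on the left lets the induction run without assuming the
weights non-negative. -/
theorem last_mul_sum_le_sum_mul {p : ℕ} {w d : Fin (p + 1) → ℝ} (hw : Antitone w)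
    (hd : ∀ k, 0 ≤ ∑ j ∈ Finset.Iic k, d j) : w (Fin.last p) * ∑ j, d j ≤ ∑ j, w j * d j := by
  induction p with
  | zero => simp
  | succ p ih =>
    have hIic : ∀ k : Fin (p + 1), ∑ j ∈ Finset.Iic k.castSucc, d j =
        ∑ j ∈ Finset.Iic k, d j.castSucc := by
      intro k
      have e : ∀ (n : ℕ) (g : Fin n → ℝ) (k : Fin n),
          ∑ j ∈ Finset.Iic k, g j = ∑ j, if j ≤ k then g j else 0 := by
        intro n g k
        rw [← Finset.sum_filter]
        congr 1
        ext; simp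
      rw [e, e, Fin.sum_univ_castSucc]
      have hk : ¬ Fin.last (p + 1) ≤ k.castSucc := (Fin.castSucc_lt_last k).not_ge
      simp [hk]
    have h1 := ih (w := fun j => w j.castSucc) (d := fun j => d j.castSucc)
      (hw.comp_monotone Fin.strictMono_castSucc.monotone)
      (fun k => (hd k.castSucc).trans_eq (hIic k))
    have h2 : 0 ≤ ∑ j : Fin (p + 1), d j.castSucc := by
      have := hd (Fin.last p).castSucc
      rwa [hIic, show Finset.Iic (Fin.last p) = Finset.univ from by ext; simp [Fin.le_last]] at this
    have h3 : w (Fin.last (p + 1)) ≤ w (Fin.last p).castSucc := hw (Fin.le_last _)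
    rw [Fin.sum_univ_castSucc d, Fin.sum_univ_castSucc fun j => w j * d j, mul_add]
    have := mul_le_mul_of_nonneg_right h3 h2
    linarith

theorem sum_mul_nonneg_of_antitone {p : ℕ} {w d : Fin p → ℝ} (hw : Antitone w)
    (hw0 : ∀ i, 0 ≤ w i) (hd : ∀ k, 0 ≤ ∑ j ∈ Finset.Iic k, d j) : 0 ≤ ∑ j, w j * d j := by
  rcases p with _ | p
  · simp
  · refine le_trans (mul_nonneg (hw0 (Fin.last p)) ?_) (last_mul_sum_le_sum_mul hw hd)
    have := hd (Fin.last p)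
    rwa [show Finset.Iic (Fin.last p) = Finset.univ from by ext; simp [Fin.le_last]] at this

/-- The convex function `t ↦ log ((t + y) / (t + x))` lies above its tangent at `s`. Here this
follows from `1 - u⁻¹ ≤ log u`, the remainder being a multiple of `(s - t) ^ 2`. -/
theorem tangent_le_log {s t x y : ℝ} (hs : 0 < s) (ht : 0 < t) (hx : 0 ≤ x) (hxy : x ≤ y) :
    (y - x) / ((s + x) * (s + y)) * (s - t) ≤
      Real.log ((s + x) * (t + y) / ((s + y) * (t + x))) := by
  have hy : 0 ≤ y := hx.trans hxy
  have h1 := Real.one_sub_inv_le_log_of_pos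
    (show 0 < (s + x) * (t + y) / ((s + y) * (t + x)) by positivity)
  refine le_trans (le_of_sub_nonneg ?_) h1
  have : 1 - ((s + x) * (t + y) / ((s + y) * (t + x)))⁻¹ -
      (y - x) / ((s + x) * (s + y)) * (s - t) =
      (y - x) * (s - t) ^ 2 / ((s + x) * (s + y) * (t + y)) := by
    field_simp
    ring
  rw [this]
  have := sub_nonneg.mpr hxy
  positivity

theorem tangent_lt_log {s t x y : ℝ} (hs : 0 < s) (ht : 0 < t) (hx : 0 ≤ x) (hxy : x < y)
    (hst : s ≠ t) : (y - x) / ((s + x) * (s + y)) * (s - t) <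
      Real.log ((s + x) * (t + y) / ((s + y) * (t + x))) := by
  have hy : 0 ≤ y := hx.trans hxy.le
  have h1 := Real.one_sub_inv_le_log_of_pos
    (show 0 < (s + x) * (t + y) / ((s + y) * (t + x)) by positivity)
  refine lt_of_lt_of_le (lt_of_sub_pos ?_) h1
  have : 1 - ((s + x) * (t + y) / ((s + y) * (t + x)))⁻¹ -
      (y - x) / ((s + x) * (s + y)) * (s - t) =
      (y - x) * (s - t) ^ 2 / ((s + x) * (s + y) * (t + y)) := by
    field_simp
    ring
  rw [this]
  have h2 := sub_pos.mpr hxy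
  have h3 := sub_ne_zero.mpr hst
  positivity

variable {p q : ℕ} {a : Fin p → ℝ}

/-- The tangent slopes decrease because `a` increases, so Abel summation applies to the partial sums
of `a - c`. -/
theorem tangent_sum_nonneg {c : Fin p → ℝ} (ha : ∀ i, 0 < a i) (hmono : Monotone a)
    (hsum : ∀ k, ∑ j ∈ Finset.Iic k, c j ≤ ∑ j ∈ Finset.Iic k, a j) {x y : ℝ} (hx : 0 ≤ x)
    (hxy : x ≤ y) : 0 ≤ ∑ i, (y - x) / ((a i + x) * (a i + y)) * (a i - c i) := by
  have hy : 0 ≤ y := hx.trans hxy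
  have h0 := sub_nonneg.mpr hxy
  refine sum_mul_nonneg_of_antitone (fun i j hij => ?_) (fun i => ?_) fun k => ?_
  · have := hmono hij
    have := ha i
    have := ha j
    gcongr
  · have := ha i
    positivity
  · rw [Finset.sum_sub_distrib]
    exact sub_nonneg.mpr (hsum k)

theorem sum_log_eq {c : Fin p → ℝ} (ha : ∀ i, 0 < a i) (hc : ∀ i, 0 < c i) {x y : ℝ}
    (hx : 0 ≤ x) (hy : 0 ≤ y) :
    ∑ i, Real.log ((a i + x) * (c i + y) / ((a i + y) * (c i + x))) =
      Real.log (((∏ i, (a i + x)) * ∏ i, (c i + y)) / ((∏ i, (a i + y)) * ∏ i, (c i + x))) := by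
  rw [← Real.log_prod, Finset.prod_div_distrib, Finset.prod_mul_distrib, Finset.prod_mul_distrib]
  intro i _
  have := ha i
  have := hc i
  positivity

theorem prod_add_pos (ha : ∀ i, 0 < a i) {x : ℝ} (hx : 0 ≤ x) : 0 < ∏ i, (a i + x) :=
  Finset.prod_pos fun i _ => add_pos_of_pos_of_nonneg (ha i) hx

theorem prod_mul_prod_le_of_sum_le {c : Fin p → ℝ} (ha : ∀ i, 0 < a i) (hc : ∀ i, 0 < c i)
    (hmono : Monotone a) (hsum : ∀ k, ∑ j ∈ Finset.Iic k, c j ≤ ∑ j ∈ Finset.Iic k, a j)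
    {x y : ℝ} (hx : 0 ≤ x) (hxy : x ≤ y) :
    (∏ i, (a i + y)) * ∏ i, (c i + x) ≤ (∏ i, (a i + x)) * ∏ i, (c i + y) := by
  have hy := hx.trans hxy
  have h := (tangent_sum_nonneg ha hmono hsum hx hxy).trans
    (Finset.sum_le_sum fun i _ => tangent_le_log (ha i) (hc i) hx hxy)
  have h1 := mul_pos (prod_add_pos ha hx) (prod_add_pos hc hy)
  have h2 := mul_pos (prod_add_pos ha hy) (prod_add_pos hc hx)
  rwa [sum_log_eq ha hc hx hy, Real.log_nonneg_iff (div_pos h1 h2), one_le_div h2] at h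

theorem prod_mul_prod_lt_of_sum_le {c : Fin p → ℝ} (ha : ∀ i, 0 < a i) (hc : ∀ i, 0 < c i)
    (hmono : Monotone a) (hsum : ∀ k, ∑ j ∈ Finset.Iic k, c j ≤ ∑ j ∈ Finset.Iic k, a j)
    (hne : a ≠ c) {x y : ℝ} (hx : 0 ≤ x) (hxy : x < y) :
    (∏ i, (a i + y)) * ∏ i, (c i + x) < (∏ i, (a i + x)) * ∏ i, (c i + y) := by
  have hy := hx.trans hxy.le
  obtain ⟨i, hi⟩ := Function.ne_iff.mp hne
  have h := (tangent_sum_nonneg ha hmono hsum hx hxy.le).trans_lt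
    (Finset.sum_lt_sum (fun i _ => tangent_le_log (ha i) (hc i) hx hxy.le)
      ⟨i, Finset.mem_univ i, tangent_lt_log (ha i) (hc i) hx hxy hi⟩)
  have h1 := mul_pos (prod_add_pos ha hx) (prod_add_pos hc hy)
  have h2 := mul_pos (prod_add_pos ha hy) (prod_add_pos hc hx)
  rwa [sum_log_eq ha hc hx hy, Real.log_pos_iff (div_pos h1 h2).le, one_lt_div h2] at h

theorem prod_eq_prod_embedding_mul (n : Fin p ↪ Fin q) (g : Fin q → ℝ) :
    ∏ j, g j = (∏ i, g (n i)) * ∏ j ∈ (Finset.univ.map n)ᶜ, g j := by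
  rw [← Finset.prod_mul_prod_compl (Finset.univ.map n) g, Finset.prod_map]

variable {b : Fin q → ℝ}

theorem MajorizationCondition.prod_mul_prod_le (hab : MajorizationCondition a b)
    (ha : ∀ i, 0 < a i) (hb : ∀ j, 0 < b j) {x y : ℝ} (hx : 0 ≤ x) (hxy : x ≤ y) :
    (∏ i, (a i + y)) * ∏ j, (b j + x) ≤ (∏ i, (a i + x)) * ∏ j, (b j + y) := by
  obtain ⟨hmono, n, hn⟩ := hab
  have hy := hx.trans hxy
  have h := prod_mul_prod_le_of_sum_le ha (fun i => hb (n i)) hmono hn hx hxy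
  rw [prod_eq_prod_embedding_mul n, prod_eq_prod_embedding_mul n fun j => b j + y,
    ← mul_assoc, ← mul_assoc]
  refine mul_le_mul h (Finset.prod_le_prod (fun j _ => ?_) fun j _ => ?_)
    (Finset.prod_nonneg fun j _ => ?_)
    (mul_pos (prod_add_pos ha hx) (prod_add_pos (fun i => hb (n i)) hy)).le
  · exact (add_pos_of_pos_of_nonneg (hb j) hx).le
  · linarith
  · exact (add_pos_of_pos_of_nonneg (hb j) hx).le

theorem MajorizationCondition.prod_mul_prod_lt (hab : MajorizationCondition a b)
    (ha : ∀ i, 0 < a i) (hb : ∀ j, 0 < b j) (hne : paramMultiset a ≠ paramMultiset b) :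
    (∏ i, (a i + 1)) * ∏ j, (b j + 0) < (∏ i, (a i + 0)) * ∏ j, (b j + 1) := by
  obtain ⟨hmono, n, hn⟩ := hab
  rw [prod_eq_prod_embedding_mul n, prod_eq_prod_embedding_mul n fun j => b j + 1,
    ← mul_assoc, ← mul_assoc]
  have hpos : 0 < ∏ j ∈ (Finset.univ.map n)ᶜ, (b j + 0) :=
    Finset.prod_pos fun j _ => by simpa using hb j
  have hrest : ∏ j ∈ (Finset.univ.map n)ᶜ, (b j + 0) ≤ ∏ j ∈ (Finset.univ.map n)ᶜ, (b j + 1) :=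
    Finset.prod_le_prod (fun j _ => by simpa using (hb j).le) fun j _ => by simp
  have hle := prod_mul_prod_le_of_sum_le ha (fun i => hb (n i)) hmono hn le_rfl zero_le_one
  have hpos' : 0 < (∏ i, (a i + 0)) * ∏ i, (b (n i) + 1) :=
    mul_pos (prod_add_pos ha le_rfl) (prod_add_pos (fun i => hb (n i)) zero_le_one)
  -- If the selected `b`'s are exactly `a`, some index is left over and its factor is strictly
  -- increasing; otherwise a tangent inequality is strict.
  by_cases hac : a = fun i => b (n i)
  · have hrest' : ((Finset.univ.map n)ᶜ).Nonempty := by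
      by_contra hemp
      rw [Finset.not_nonempty_iff_eq_empty, Finset.compl_eq_empty_iff] at hemp
      refine hne ?_
      rw [paramMultiset, paramMultiset, ← hemp, Finset.map_val, Multiset.map_map, hac]
      rfl
    refine mul_lt_mul' hle ?_ hpos.le hpos'
    exact Finset.prod_lt_prod_of_nonempty (fun j _ => by simpa using hb j)
      (fun j _ => by simp) hrest'
  · have hlt := prod_mul_prod_lt_of_sum_le ha (fun i => hb (n i)) hmono hn hac le_rfl zero_lt_one
    exact mul_lt_mul hlt hrest hpos hpos'.le

end Majorization

/-! ### The weights and convergence of the series. -/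

section PochQuot

variable {p q : ℕ} {a : Fin p → ℝ} {b : Fin q → ℝ}

theorem pochQuot_zero : pochQuot a b 0 = 1 := by simp [pochQuot]

theorem pochQuot_pos (ha : ∀ i, 0 < a i) (hb : ∀ j, 0 < b j) (k : ℕ) : 0 < pochQuot a b k :=
  div_pos (Finset.prod_pos fun i _ => ascPochhammer_pos k _ (ha i))
    (Finset.prod_pos fun j _ => ascPochhammer_pos k _ (hb j))

theorem pochQuot_swap (k : ℕ) : pochQuot b a k = (pochQuot a b k)⁻¹ := by
  rw [pochQuot, pochQuot, inv_div]

theorem pochQuot_succ (k : ℕ) :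
    pochQuot a b (k + 1) = (∏ i, (a i + k)) / (∏ j, (b j + k)) * pochQuot a b k := by
  simp only [pochQuot, ascPochhammer_succ_eval, Finset.prod_mul_distrib]
  rw [mul_div_mul_comm, mul_comm]

theorem tendsto_add_natCast_div (c : ℝ) :
    Tendsto (fun k : ℕ => (c + k) / k) atTop (𝓝 1) := by
  have h : Tendsto (fun k : ℕ => c / (k : ℝ) + 1) atTop (𝓝 (0 + 1)) :=
    (tendsto_const_div_atTop_nhds_zero_nat c).add_const 1
  rw [zero_add] at h
  refine h.congr' ?_
  filter_upwards [eventually_ne_atTop 0] with k hk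
  have : (k : ℝ) ≠ 0 := by exact_mod_cast hk
  field_simp

theorem tendsto_pochQuot_ratio (hpq : p ≤ q) :
    Tendsto (fun k : ℕ => (∏ i, (a i + k)) / ∏ j, (b j + (k : ℝ))) atTop (𝓝 (0 ^ (q - p))) := by
  have h1 : Tendsto (fun k : ℕ => ∏ i, (a i + k) / (k : ℝ)) atTop (𝓝 (∏ _i : Fin p, 1)) :=
    tendsto_finsetProd _ fun i _ => tendsto_add_natCast_div (a i)
  have h2 : Tendsto (fun k : ℕ => ∏ j, (b j + k) / (k : ℝ)) atTop (𝓝 (∏ _j : Fin q, 1)) :=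
    tendsto_finsetProd _ fun j _ => tendsto_add_natCast_div (b j)
  have h3 : Tendsto (fun k : ℕ => (1 / (k : ℝ)) ^ (q - p)) atTop (𝓝 (0 ^ (q - p))) :=
    tendsto_one_div_atTop_nhds_zero_nat.pow _
  have h := (h1.div h2 (by simp)).mul h3
  simp only [Finset.prod_const_one, div_one, one_mul] at h
  refine h.congr' ?_
  filter_upwards [eventually_ne_atTop 0] with k hk
  have hk : (k : ℝ) ≠ 0 := by exact_mod_cast hk
  simp only [Pi.div_apply, Finset.prod_div_distrib, Finset.prod_const, Finset.card_univ,
    Fintype.card_fin]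
  obtain ⟨r, rfl⟩ := Nat.exists_eq_add_of_le hpq
  rw [Nat.add_sub_cancel_left, pow_add, one_div, inv_pow]
  field_simp

theorem baseCoeff_succ_le {ν : ℝ} (hν : 0 ≤ ν) {k : ℕ} (hk : ν ^ 2 ≤ k) :
    baseCoeff (k + 1) ν ≤ baseCoeff k ν := by
  have h := baseCoeff_nonneg k hν
  have h1 : 0 < (ascPochhammer ℝ k).eval (ν + 1) := ascPochhammer_pos _ _ (by linarith)
  have e : baseCoeff (k + 1) ν =
      baseCoeff k ν * (((ν / 2 + k) * (ν / 2 + 1 / 2 + k)) / ((ν + 1 + k) * (k + 1))) := by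
    simp only [baseCoeff, ascPochhammer_succ_eval, Nat.factorial_succ]
    push_cast
    field_simp
  rw [e]
  refine mul_le_of_le_one_right h ((div_le_one (by positivity)).mpr ?_)
  nlinarith

theorem summable_pochQuot_mul_baseCoeff (hpq : p ≤ q) (ha : ∀ i, 0 < a i) (hb : ∀ j, 0 < b j)
    {x : ℝ} (hx : 0 < x) (hx1 : p = q → x < 1) {ν : ℝ} (hν : 0 ≤ ν) :
    Summable fun n : ℕ => pochQuot a b n * baseCoeff n ν * x ^ n := by
  have hlim := (tendsto_pochQuot_ratio (a := a) (b := b) hpq).mul_const x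
  -- The limit of the weight ratios is `0 ^ (q - p)`, which is `1` for `p = q` and `0` for `p < q`.
  have hlt : 0 ^ (q - p) * x < 1 := by
    rcases hpq.eq_or_lt with h | h
    · simpa [h] using hx1 h
    · rw [zero_pow (by omega), zero_mul]; exact one_pos
  obtain ⟨r, hr, hr1⟩ := exists_between hlt
  obtain ⟨N, hN⟩ := exists_nat_ge (ν ^ 2)
  refine summable_of_ratio_norm_eventually_le hr1 ?_
  filter_upwards [hlim.eventually_lt_const hr, eventually_ge_atTop N] with n hn hnN
  have hf := pochQuot_pos ha hb n
  have hd := baseCoeff_nonneg n hν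
  have hd' := baseCoeff_nonneg (n + 1) hν
  have hdle := baseCoeff_succ_le hν (hN.trans (Nat.cast_le.mpr hnN))
  have hR := prod_add_pos ha (Nat.cast_nonneg (α := ℝ) n)
  have hR' := prod_add_pos hb (Nat.cast_nonneg (α := ℝ) n)
  have hf' := pochQuot_pos ha hb (n + 1)
  have hr0 : 0 ≤ r := (mul_pos (div_pos hR hR') hx).le.trans hn.le
  rw [Real.norm_of_nonneg (by positivity), Real.norm_of_nonneg (by positivity), pochQuot_succ]
  calc (∏ i, (a i + n)) / (∏ j, (b j + (n : ℝ))) * pochQuot a b n * baseCoeff (n + 1) ν *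
        x ^ (n + 1)
      = ((∏ i, (a i + n)) / (∏ j, (b j + (n : ℝ))) * x) *
          (pochQuot a b n * baseCoeff (n + 1) ν * x ^ n) := by ring
    _ ≤ r * (pochQuot a b n * baseCoeff n ν * x ^ n) := by gcongr

end PochQuot

/-! ### From coefficients to function values. -/

theorem hasSum_coeff_mul {φ ψ : PowerSeries ℝ} {x : ℝ}
    (hφ : Summable fun n => ‖coeff n φ * x ^ n‖) (hψ : Summable fun n => ‖coeff n ψ * x ^ n‖) :
    HasSum (fun n => coeff n (φ * ψ) * x ^ n)
      ((∑' n, coeff n φ * x ^ n) * ∑' n, coeff n ψ * x ^ n) := by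
  rw [tsum_mul_tsum_eq_tsum_sum_antidiagonal_of_summable_norm hφ hψ]
  have h := (summable_norm_sum_mul_antidiagonal_of_summable_norm hφ hψ).of_norm.hasSum
  refine h.congr_fun fun n => ?_
  rw [PowerSeries.coeff_mul, Finset.sum_mul]
  refine Finset.sum_congr rfl fun y hy => ?_
  rw [← Finset.HasAntidiagonal.mem_antidiagonal.mp hy, pow_add]
  ring

/-- The sum of the series `weightedSeries f ν` at `x`. -/
noncomputable def weightedFun (f : ℕ → ℝ) (x ν : ℝ) : ℝ :=
  ∑' n : ℕ, f n * baseCoeff n ν * x ^ n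

/-- The middle term is `1 / 8`, and the two equal outer terms cancel it because all three sum to
zero. -/
theorem coeff_two_turan (f : ℕ → ℝ) {μ : ℝ} (hμ : 0 ≤ μ) :
    coeff 2 (weightedSeries f (μ + 1) * weightedSeries f (μ + 1) -
        weightedSeries f μ * weightedSeries f (μ + 1 + 1)) =
      (f 1 * f 1 - f 0 * f 2) / 16 := by
  have h := two_mul_coeff_turan f μ 1 2
  have h0 := sum_symTerm (σ := 1) zero_le_one hμ 2
  have h1 : symTerm 1 μ 1 1 = 1 / 8 := by
    have e : ∀ ν : ℝ, 0 ≤ ν → baseCoeff 1 ν = ν / 4 := fun ν hν => by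
      rw [baseCoeff_succ 0 hν]; simp [baseFactor]; ring
    rw [symTerm, e _ hμ, e _ (by positivity), e _ (by positivity)]
    ring
  simp only [Finset.Nat.antidiagonal_succ, Finset.Nat.antidiagonal_zero] at h h0
  simp [h1, symTerm_comm 1 μ 2 0] at h h0
  rw [map_sub]
  linear_combination h / 2 + f 0 * f 2 * h0 / 2

section Weighted

variable {f : ℕ → ℝ} {x : ℝ}

theorem weightedFun_pos (hf0 : f 0 = 1) (hf : ∀ k, 0 < f k) (hx : 0 < x) {ν : ℝ} (hν : 0 ≤ ν)
    (hs : Summable fun n : ℕ => f n * baseCoeff n ν * x ^ n) : 0 < weightedFun f x ν := by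
  have hn : ∀ n, 0 ≤ f n * baseCoeff n ν * x ^ n := fun n =>
    mul_nonneg (mul_nonneg (hf n).le (baseCoeff_nonneg n hν)) (pow_pos hx n).le
  have := hs.le_tsum 0 fun n _ => hn n
  simp only [hf0, baseCoeff_zero, pow_zero, mul_one] at this
  exact one_pos.trans_le this

theorem mul_turan_weightedFun {c : ℝ}
    (hc : ∀ k n k' n', k + n = k' + n' → k * n ≤ k' * n' →
      c * (f k * f n) ≤ c * (f k' * f n')) (hx : 0 < x)
    (hs : ∀ ν : ℝ, 0 ≤ ν → Summable fun n : ℕ => f n * baseCoeff n ν * x ^ n)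
    {μ : ℝ} (hμ : 0 ≤ μ) :
    c * ((f 1 * f 1 - f 0 * f 2) / 16) * x ^ 2 ≤
      c * (weightedFun f x (μ + 1) * weightedFun f x (μ + 1) -
        weightedFun f x μ * weightedFun f x (μ + 1 + 1)) := by
  have hs' : ∀ ν : ℝ, 0 ≤ ν → Summable fun n => ‖coeff n (weightedSeries f ν) * x ^ n‖ := by
    intro ν hν
    simpa only [weightedSeries, coeff_mk] using (hs ν hν).norm
  have e : ∀ ν : ℝ, ∑' n, coeff n (weightedSeries f ν) * x ^ n = weightedFun f x ν := by
    intro ν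
    simp only [weightedSeries, coeff_mk, weightedFun]
  have h1 : 0 ≤ μ + 1 := by positivity
  have h2 : 0 ≤ μ + 1 + 1 := by positivity
  have h := ((hasSum_coeff_mul (hs' _ h1) (hs' _ h1)).sub
    (hasSum_coeff_mul (hs' _ hμ) (hs' _ h2))).mul_left c
  simp only [e, ← sub_mul, ← map_sub, ← mul_assoc] at h
  rw [← coeff_two_turan f hμ]
  -- All terms are non-negative, so the sum dominates its `x ^ 2` term; this bound later supplies
  -- strictness.
  refine le_hasSum h 2 fun n _ => mul_nonneg ?_ (pow_pos hx n).le
  exact mul_coeff_turan_nonneg hc (Or.inl rfl) hμ n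

end Weighted

theorem log_concave_mul_le {u : ℕ → ℝ} (hu : ∀ n, 0 < u n)
    (h : ∀ n, u n * u (n + 2) ≤ u (n + 1) * u (n + 1)) {k n k' n' : ℕ} (hkn : k + n = k' + n')
    (hmul : k * n ≤ k' * n') : u k * u n ≤ u k' * u n' := by
  refine mul_le_mul_of_ratio_antitone (R := fun k => u (k + 1) / u k) hu (fun k => ?_)
    (antitone_nat_of_succ_le fun k => ?_) hkn hmul
  · rw [div_mul_cancel₀ _ (hu k).ne']
  · rw [div_le_div_iff₀ (hu _) (hu _)]
    linarith [h k]

theorem log_concave_mul_lt {u : ℕ → ℝ} (hu : ∀ n, 0 < u n)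
    (h : ∀ n, u n * u (n + 2) < u (n + 1) * u (n + 1)) {α β : ℕ} (hα : 1 ≤ α) (hβ : 1 ≤ β) :
    u 0 * u (α + β) < u α * u β := by
  obtain ⟨i, rfl⟩ := Nat.exists_eq_add_of_le' hα
  obtain ⟨j, rfl⟩ := Nat.exists_eq_add_of_le' hβ
  -- Only the first inward move, from `(0, α + β)` to `(1, α + β - 1)`, is taken strictly; this is
  -- the remaining weak part.
  have hle := log_concave_mul_le hu (fun n => (h n).le) (k := 1) (n := i + j + 1)
    (k' := i + 1) (n' := j + 1) (by ring) (by nlinarith)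
  refine lt_of_lt_of_le ?_ hle
  have hanti : StrictAnti fun k => u (k + 1) / u k := strictAnti_nat_of_succ_lt fun k => by
    rw [div_lt_div_iff₀ (hu _) (hu _)]
    linarith [h k]
  have := hanti (show 0 < i + j + 1 by omega)
  rw [div_lt_div_iff₀ (hu _) (hu _)] at this
  rw [show i + 1 + (j + 1) = i + j + 1 + 1 by ring]
  linarith

/-! ### Assembly of the inequalities. -/

section Main

variable {p q : ℕ} {a : Fin p → ℝ} {b : Fin q → ℝ}

theorem prod_mul_prod_le_of_conditions (hpq : p ≤ q) (ha : ∀ i, 0 < a i) (hb : ∀ j, 0 < b j)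
    (hab : SymmetricChain a b ∨ MajorizationCondition a b) {x y : ℝ} (hx : 0 ≤ x) (hxy : x ≤ y) :
    (∏ i, (a i + y)) * ∏ j, (b j + x) ≤ (∏ i, (a i + x)) * ∏ j, (b j + y) :=
  hab.elim (fun h => h.prod_mul_prod_le hpq ha hb hx hxy)
    fun h => h.prod_mul_prod_le ha hb hx hxy

theorem pochQuot_mul_le (hpq : p ≤ q) (ha : ∀ i, 0 < a i) (hb : ∀ j, 0 < b j)
    (hab : SymmetricChain a b ∨ MajorizationCondition a b) {k n k' n' : ℕ}
    (h : k + n = k' + n') (hmul : k * n ≤ k' * n') :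
    pochQuot a b k * pochQuot a b n ≤ pochQuot a b k' * pochQuot a b n' := by
  refine mul_le_mul_of_ratio_antitone (pochQuot_pos ha hb) pochQuot_succ (fun m n hmn => ?_) h hmul
  rw [div_le_div_iff₀ (prod_add_pos hb n.cast_nonneg) (prod_add_pos hb m.cast_nonneg)]
  exact prod_mul_prod_le_of_conditions hpq ha hb hab m.cast_nonneg (Nat.cast_le.mpr hmn)

theorem pochQuot_two_lt (hpq : p ≤ q) (ha : ∀ i, 0 < a i) (hb : ∀ j, 0 < b j)
    (hab : SymmetricChain a b ∨ MajorizationCondition a b)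
    (hne : paramMultiset a ≠ paramMultiset b) :
    pochQuot a b 2 < pochQuot a b 1 * pochQuot a b 1 := by
  have h : (∏ i, (a i + 1)) * ∏ j, (b j + 0) < (∏ i, (a i + 0)) * ∏ j, (b j + 1) :=
    hab.elim (fun h => h.prod_mul_prod_lt hpq ha hb hne) fun h => h.prod_mul_prod_lt ha hb hne
  rw [← div_lt_div_iff₀ (prod_add_pos hb zero_le_one) (prod_add_pos hb le_rfl)] at h
  have h2 := pochQuot_succ (a := a) (b := b) 1
  have h1 := pochQuot_succ (a := a) (b := b) 0
  rw [pochQuot_zero, mul_one, Nat.cast_zero] at h1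
  rw [Nat.cast_one] at h2
  rw [h2]
  refine mul_lt_mul_of_pos_right ?_ (pochQuot_pos ha hb 1)
  rwa [← h1, zero_add] at h

theorem pochQuot_swap_mul_le (hpq : p ≤ q) (ha : ∀ i, 0 < a i) (hb : ∀ j, 0 < b j)
    (hab : SymmetricChain a b ∨ MajorizationCondition a b) {k n k' n' : ℕ}
    (h : k + n = k' + n') (hmul : k * n ≤ k' * n') :
    pochQuot b a k' * pochQuot b a n' ≤ pochQuot b a k * pochQuot b a n := by
  simp only [pochQuot_swap (a := a) (b := b), ← mul_inv]
  exact inv_anti₀ (mul_pos (pochQuot_pos ha hb k) (pochQuot_pos ha hb n))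
    (pochQuot_mul_le hpq ha hb hab h hmul)

theorem pochQuot_swap_lt_two (hpq : p ≤ q) (ha : ∀ i, 0 < a i) (hb : ∀ j, 0 < b j)
    (hab : SymmetricChain a b ∨ MajorizationCondition a b)
    (hne : paramMultiset a ≠ paramMultiset b) :
    pochQuot b a 1 * pochQuot b a 1 < pochQuot b a 2 := by
  simp only [pochQuot_swap (a := a) (b := b), ← mul_inv]
  exact inv_strictAnti₀ (pochQuot_pos ha hb 2) (pochQuot_two_lt hpq ha hb hab hne)

theorem hyperSeries_eq_weightedSeries (a : Fin p → ℝ) (b : Fin q → ℝ) :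
    (fun ν => hyperSeries (upperParams a ν) (lowerParams b ν)) =
      weightedSeries (pochQuot a b) := by
  funext ν
  ext n
  simp only [hyperSeries, weightedSeries, coeff_mk, hyperCoeff_upper_lower]

theorem hyperFun_eq_weightedFun (a : Fin p → ℝ) (b : Fin q → ℝ) (x : ℝ) :
    (fun ν => hyperFun (upperParams a ν) (lowerParams b ν) x) =
      weightedFun (pochQuot a b) x := by
  funext ν
  simp only [hyperFun, weightedFun, hyperCoeff_upper_lower]

theorem turanian_weightedFun_nonneg {f : ℕ → ℝ} {x : ℝ} (hf0 : f 0 = 1) (hf : ∀ k, 0 < f k)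
    (hlc : ∀ k n k' n', k + n = k' + n' → k * n ≤ k' * n' → f k * f n ≤ f k' * f n')
    (hx : 0 < x) (hs : ∀ ν : ℝ, 0 ≤ ν → Summable fun n : ℕ => f n * baseCoeff n ν * x ^ n)
    {μ : ℝ} (hμ : 0 ≤ μ) {α β : ℕ} (hα : 1 ≤ α) (hβ : 1 ≤ β) :
    0 ≤ turanian (weightedFun f x) μ α β ∧
      (f 2 < f 1 * f 1 → 0 < turanian (weightedFun f x) μ α β) := by
  have hμn : ∀ n : ℕ, 0 ≤ μ + n := fun n => by positivity
  have hu : ∀ n : ℕ, 0 < weightedFun f x (μ + n) := fun n =>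
    weightedFun_pos hf0 hf hx (hμn n) (hs _ (hμn n))
  have hc : f 2 ≤ f 1 * f 1 := by simpa [hf0] using hlc 0 2 1 1 rfl (by norm_num)
  have step : ∀ n : ℕ, (f 1 * f 1 - f 2) / 16 * x ^ 2 ≤
      weightedFun f x (μ + (n + 1 : ℕ)) * weightedFun f x (μ + (n + 1 : ℕ)) -
        weightedFun f x (μ + n) * weightedFun f x (μ + (n + 2 : ℕ)) := by
    intro n
    have := mul_turan_weightedFun (c := 1) (by simpa using hlc) hx hs (hμn n)
    simp only [one_mul, hf0] at this
    rwa [show μ + ((n + 1 : ℕ) : ℝ) = μ + n + 1 by push_cast; ring,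
      show μ + ((n + 2 : ℕ) : ℝ) = μ + n + 1 + 1 by push_cast; ring]
  have hx2 := pow_pos hx 2
  have e : turanian (weightedFun f x) μ α β = weightedFun f x (μ + α) * weightedFun f x (μ + β) -
      weightedFun f x (μ + (0 : ℕ)) * weightedFun f x (μ + (α + β : ℕ)) := by
    rw [turanian, Nat.cast_zero, add_zero, Nat.cast_add, add_assoc]
  rw [e]
  constructor
  · refine sub_nonneg.mpr (log_concave_mul_le (u := fun n : ℕ => weightedFun f x (μ + n)) hu
      (fun n => ?_) (zero_add _) (by simp))
    have h0 : 0 ≤ (f 1 * f 1 - f 2) / 16 * x ^ 2 :=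
      mul_nonneg (div_nonneg (sub_nonneg.mpr hc) (by norm_num)) hx2.le
    exact sub_nonneg.mp (h0.trans (step n))
  · intro hlt
    refine sub_pos.mpr (log_concave_mul_lt (u := fun n : ℕ => weightedFun f x (μ + n)) hu
      (fun n => ?_) hα hβ)
    have h0 : 0 < (f 1 * f 1 - f 2) / 16 * x ^ 2 :=
      mul_pos (div_pos (sub_pos.mpr hlt) (by norm_num)) hx2
    exact sub_pos.mp (h0.trans_le (step n))

/-- Log-convexity of the values is log-concavity of their reciprocals, so the same sequence lemmas
apply. -/
theorem turanian_weightedFun_nonpos {f : ℕ → ℝ} {x : ℝ} (hf0 : f 0 = 1) (hf : ∀ k, 0 < f k)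
    (hlc : ∀ k n k' n', k + n = k' + n' → k * n ≤ k' * n' → f k' * f n' ≤ f k * f n)
    (hx : 0 < x) (hs : ∀ ν : ℝ, 0 ≤ ν → Summable fun n : ℕ => f n * baseCoeff n ν * x ^ n)
    {μ : ℝ} (hμ : 0 ≤ μ) {α β : ℕ} (hα : 1 ≤ α) (hβ : 1 ≤ β) :
    turanian (weightedFun f x) μ α β ≤ 0 ∧
      (f 1 * f 1 < f 2 → turanian (weightedFun f x) μ α β < 0) := by
  have hμn : ∀ n : ℕ, 0 ≤ μ + n := fun n => by positivity
  have hu : ∀ n : ℕ, 0 < weightedFun f x (μ + n) := fun n =>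
    weightedFun_pos hf0 hf hx (hμn n) (hs _ (hμn n))
  have hu' : ∀ n : ℕ, 0 < (weightedFun f x (μ + n))⁻¹ := fun n => inv_pos.mpr (hu n)
  have hc : f 1 * f 1 ≤ f 2 := by simpa [hf0] using hlc 0 2 1 1 rfl (by norm_num)
  have step : ∀ n : ℕ, (f 2 - f 1 * f 1) / 16 * x ^ 2 ≤
      weightedFun f x (μ + n) * weightedFun f x (μ + (n + 2 : ℕ)) -
      weightedFun f x (μ + (n + 1 : ℕ)) * weightedFun f x (μ + (n + 1 : ℕ)) := by
    intro n
    have := mul_turan_weightedFun (c := -1)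
      (fun k n k' n' h h' => by linarith [hlc k n k' n' h h']) hx hs (hμn n)
    rw [hf0] at this
    rw [show μ + ((n + 1 : ℕ) : ℝ) = μ + n + 1 by push_cast; ring,
      show μ + ((n + 2 : ℕ) : ℝ) = μ + n + 1 + 1 by push_cast; ring]
    linarith
  have hx2 := pow_pos hx 2
  have e : turanian (weightedFun f x) μ α β = weightedFun f x (μ + α) * weightedFun f x (μ + β) -
      weightedFun f x (μ + (0 : ℕ)) * weightedFun f x (μ + (α + β : ℕ)) := by
    rw [turanian, Nat.cast_zero, add_zero, Nat.cast_add, add_assoc]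
  rw [e]
  constructor
  · have := log_concave_mul_le (u := fun n : ℕ => (weightedFun f x (μ + n))⁻¹) hu'
      (fun n => by
        have h0 : 0 ≤ (f 2 - f 1 * f 1) / 16 * x ^ 2 :=
          mul_nonneg (div_nonneg (sub_nonneg.mpr hc) (by norm_num)) hx2.le
        simp only [← mul_inv]
        exact inv_anti₀ (mul_pos (hu _) (hu _)) (sub_nonneg.mp (h0.trans (step n))))
      (zero_add (α + β)) (by simp)
    simp only [← mul_inv] at this
    exact sub_nonpos.mpr ((inv_le_inv₀ (mul_pos (hu _) (hu _)) (mul_pos (hu _) (hu _))).mp this)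
  · intro hlt
    have := log_concave_mul_lt (u := fun n : ℕ => (weightedFun f x (μ + n))⁻¹) hu'
      (fun n => by
        have h0 : 0 < (f 2 - f 1 * f 1) / 16 * x ^ 2 :=
          mul_pos (div_pos (sub_pos.mpr hlt) (by norm_num)) hx2
        simp only [← mul_inv]
        exact inv_strictAnti₀ (mul_pos (hu _) (hu _)) (sub_pos.mp (h0.trans_le (step n)))) hα hβ
    simp only [← mul_inv] at this
    exact sub_neg.mpr ((inv_lt_inv₀ (mul_pos (hu _) (hu _)) (mul_pos (hu _) (hu _))).mp this)

end Main

end TuranHypergeometric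

open TuranHypergeometric in
theorem mainTheorem6 {p q : ℕ} (hpq : p ≤ q) (a : Fin p → ℝ) (b : Fin q → ℝ)
    (ha : ∀ i, 0 < a i) (hb : ∀ j, 0 < b j)
    (hab : TuranHypergeometric.SymmetricChain a b ∨
      TuranHypergeometric.MajorizationCondition a b) :
    -- the Turán inequality for `f`, on the positive part of its domain of convergence
    (∀ x : ℝ, 0 < x → (p = q → x < 1) →
      (∀ ν : ℝ, 0 ≤ ν → Summable fun n : ℕ =>
        TuranHypergeometric.hyperCoeff (TuranHypergeometric.upperParams a ν)
          (TuranHypergeometric.lowerParams b ν) n * x ^ n) ∧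
      ∀ μ : ℝ, 0 ≤ μ → ∀ α β : ℕ, 1 ≤ α → 1 ≤ β →
        0 ≤ TuranHypergeometric.turanian (fun ν => TuranHypergeometric.hyperFun
          (TuranHypergeometric.upperParams a ν) (TuranHypergeometric.lowerParams b ν) x) μ α β ∧
        (TuranHypergeometric.paramMultiset a ≠ TuranHypergeometric.paramMultiset b →
          0 < TuranHypergeometric.turanian (fun ν => TuranHypergeometric.hyperFun
            (TuranHypergeometric.upperParams a ν) (TuranHypergeometric.lowerParams b ν) x)
            μ α β)) ∧
    -- the coefficients for `f`
    (∀ μ : ℝ, 0 ≤ μ → ∀ α β : ℕ, 1 ≤ α → 1 ≤ β → α + β ≤ 4 → ∀ k : ℕ,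
      0 ≤ PowerSeries.coeff k (TuranHypergeometric.turanian
        (fun ν => TuranHypergeometric.hyperSeries
          (TuranHypergeometric.upperParams a ν) (TuranHypergeometric.lowerParams b ν)) μ α β)) ∧
    -- the reverse Turán inequality for the function with `a` and `b` interchanged; for `p < q`
    -- its series diverges at every `x ≠ 0`
    (p = q → ∀ x : ℝ, 0 < x → x < 1 →
      (∀ ν : ℝ, 0 ≤ ν → Summable fun n : ℕ =>
        TuranHypergeometric.hyperCoeff (TuranHypergeometric.upperParams b ν)
          (TuranHypergeometric.lowerParams a ν) n * x ^ n) ∧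
      ∀ μ : ℝ, 0 ≤ μ → ∀ α β : ℕ, 1 ≤ α → 1 ≤ β →
        TuranHypergeometric.turanian (fun ν => TuranHypergeometric.hyperFun
          (TuranHypergeometric.upperParams b ν) (TuranHypergeometric.lowerParams a ν) x) μ α β
            ≤ 0 ∧
        (TuranHypergeometric.paramMultiset a ≠ TuranHypergeometric.paramMultiset b →
          TuranHypergeometric.turanian (fun ν => TuranHypergeometric.hyperFun
            (TuranHypergeometric.upperParams b ν) (TuranHypergeometric.lowerParams a ν) x)
            μ α β < 0)) ∧
    -- the coefficients for the interchanged series, formally, for all `p ≤ q`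
    (∀ μ : ℝ, 0 ≤ μ → ∀ α β : ℕ, 1 ≤ α → 1 ≤ β → α + β ≤ 4 → ∀ k : ℕ,
      PowerSeries.coeff k (TuranHypergeometric.turanian
        (fun ν => TuranHypergeometric.hyperSeries
          (TuranHypergeometric.upperParams b ν) (TuranHypergeometric.lowerParams a ν)) μ α β)
            ≤ 0) := by
  refine ⟨fun x hx hx1 => ?_, fun μ hμ α β hα hβ h k => ?_, ?_, fun μ hμ α β hα hβ h k => ?_⟩
  · have hs : ∀ ν : ℝ, 0 ≤ ν → Summable fun n : ℕ => pochQuot a b n * baseCoeff n ν * x ^ n :=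
      fun ν hν => summable_pochQuot_mul_baseCoeff hpq ha hb hx hx1 hν
    refine ⟨fun ν hν => by simpa only [hyperCoeff_upper_lower] using hs ν hν,
      fun μ hμ α β hα hβ => ?_⟩
    rw [hyperFun_eq_weightedFun]
    have := turanian_weightedFun_nonneg pochQuot_zero (pochQuot_pos ha hb)
      (fun k n k' n' h h' => pochQuot_mul_le hpq ha hb hab h h') hx hs hμ hα hβ
    exact ⟨this.1, fun hne => this.2 (pochQuot_two_lt hpq ha hb hab hne)⟩
  · rw [hyperSeries_eq_weightedSeries]
    have := mul_coeff_turanian_nonneg (c := 1) (f := pochQuot a b)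
      (fun k n k' n' h h' => by simpa using pochQuot_mul_le hpq ha hb hab h h') hμ hα hβ h k
    rwa [one_mul] at this
  · intro hpq' x hx hx1
    have hs : ∀ ν : ℝ, 0 ≤ ν → Summable fun n : ℕ => pochQuot b a n * baseCoeff n ν * x ^ n :=
      fun ν hν => summable_pochQuot_mul_baseCoeff hpq'.ge hb ha hx (fun _ => hx1) hν
    refine ⟨fun ν hν => by simpa only [hyperCoeff_upper_lower] using hs ν hν,
      fun μ hμ α β hα hβ => ?_⟩
    rw [hyperFun_eq_weightedFun]
    have := turanian_weightedFun_nonpos pochQuot_zero (pochQuot_pos hb ha)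
      (fun k n k' n' h h' => pochQuot_swap_mul_le hpq ha hb hab h h') hx hs hμ hα hβ
    exact ⟨this.1, fun hne => this.2 (pochQuot_swap_lt_two hpq ha hb hab hne)⟩
  · rw [hyperSeries_eq_weightedSeries]
    have := mul_coeff_turanian_nonneg (c := -1) (f := pochQuot b a)
      (fun k n k' n' h h' => by
        have := pochQuot_swap_mul_le hpq ha hb hab h h'
        linarith) hμ hα hβ h k
    linarith
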